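/- **Setting.** Let $\delta>0$ and $n\ge 2$. A market with participants $1,\dots,n$, participant $i$ owning one unit of good $i$, is given by a real matrix $C=(C_{ij})_{1\le i,j\le n}$ such that: (a) $C_{ij}\ge 0$; (b) for all $i,j$ there are $i=i_0,i_1,\dots,i_k=j$ with $\prod_{\ell=1}^k C_{i_{\ell-1}i_\ell}>0$; (c) $\prod_{\ell=1}^k C_{i_{\ell-1}i_\ell}=\prod_{\ell=1}^k C_{i_\ell i_{\ell-1}}$ for every closed sequence $i_0,i_1,\dots,i_k=i_0$; and (d) $\min\{C_{ij}: C_{ij}>0\}=1$ for every $i$. (Participant $i$ has the CES utility $\big(\sum_j (c_{ij}x_{ij})^\rho\big)^{1/\rho}$ with $\rho=\delta/(1+\delta)\in(0,1)$ and $C_{ij}=c_{ij}^\delta$; (d) is a normalization.) By (b) and (c), $C_{ij}>0$ if and only if $C_{ji}>0$; write $i\sim j$ in this case ($i=j$ is allowed). At prices $p\in(0,\infty)^n$ the demand of $i$ for good $j$ is $$d_{ij}(p)=\frac{p_i\,C_{ij}}{p_j^{1+\delta}\sum_k C_{ik}\,p_k^{-\delta}},\qquad d_j=\sum_i d_{ij}.$$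 Let $r\in(0,\infty)^n$ be equilibrium prices, that is, $d_j(r)=1$ for all $j$. Let $D$ be the matrix, with entries $D_{ji}=\left.\partial d_j/\partial\alpha_i\right|_{\alpha=0}$ where $p_k=r_ke^{\alpha_k}$, of the linearization at $r$ of the dynamics $\dot p_j=(d_j-1)p_j$. **Parameters.** Let $\gamma=\max_i\sum_j C_{ij}$. For vertices $i,j$ let $\psi_{i,j}=\prod_{\ell=1}^k C_{i_{\ell-1}i_\ell}/C_{i_\ell i_{\ell-1}}$ along any path $i=i_0\sim i_1\sim\dots\sim i_k=j$ (by (c) this does not depend on the path), let $i_0$ be a vertex with $\psi_{i_0,j}\ge 1$ for all $j$, and let $\tilde\psi=\max_j\psi_{i_0,j}$. Let $U_{ij}=1$ and $E_{ij}=\sqrt{r_ir_j}$ if $i\sim j$, and $U_{ij}=E_{ij}=0$ otherwise. For a symmetric nonnegative matrix $A$ without zero row let $\mathrm{Lap}(A)=I-a^{-1}Aa^{-1}$, where $a$ is the diagonal matrix with $a_{ii}=\big(\sum_jA_{ij}\big)^{1/2}$. For a matrix with only real eigenvalues, $\lambda_{\uparrow k}$ and $\lambda_{\downarrow k}$ denote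 its $k$-th smallest and $k$-th largest eigenvalue, counted with multiplicity. Let $q(\delta,\lambda)=-(1+2\delta)\lambda+\delta\lambda^2$. **Theorem (Market comparison bounds).** All eigenvalues of $D$ are real, and: 1. (Bound through the unweighted Laplacian) $$q\Big(\delta,\min\Big\{\tilde\psi\,\gamma^{2+\delta}\,\lambda_{\uparrow2}(\mathrm{Lap}(U)),\,1+\tfrac1{2\delta},\,1+\tfrac1{n-1}\Big\}\Big)\le\lambda_{\downarrow2}(D)\le\max\Big\{q\Big(\delta,\frac{\lambda_{\uparrow2}(\mathrm{Lap}(U))}{\tilde\psi\,\gamma^{2+\delta}}\Big),\,-2\Big\}.$$ 2. (Bound through the equilibrium prices Laplacian) $$q\Big(\delta,\min\Big\{\gamma^{1+\delta}\,\lambda_{\uparrow2}(\mathrm{Lap}(E)),\,1+\tfrac1{2\delta},\,1+\tfrac1{n-1}\Big\}\Big)\le\lambda_{\downarrow2}(D)\le\max\Big\{q\Big(\delta,\frac{\lambda_{\uparrow2}(\mathrm{Lap}(E))}{\gamma^{1+\delta}}\Big),\,-2\Big\}.$$ -/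

import Mathlib

/-- The data of a market with `n ≥ 2` participants, participant `i` being endowed with one unit of
good `i`. The coefficients are `C i j = c i j ^ δ`, where `c` are the coefficients of the CES
utilities (see `Market.demand_unique_optimal`), each row being scaled so that its least positive
entry is `1`. -/
structure Market (n : ℕ) where
  two_le : 2 ≤ n
  C : Matrix (Fin n) (Fin n) ℝ
  nonneg : ∀ i j, 0 ≤ C i j
  connected : ∀ i j, ∃ (k : ℕ) (w : ℕ → Fin n), w 0 = i ∧ w k = j ∧
    0 < ∏ l ∈ Finset.range k, C (w l) (w (l + 1))
  circulation_free : ∀ (k : ℕ) (w : ℕ → Fin n), w k = w 0 →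
    ∏ l ∈ Finset.range k, C (w l) (w (l + 1)) = ∏ l ∈ Finset.range k, C (w (l + 1)) (w l)
  normalized : ∀ i, IsLeast {x : ℝ | 0 < x ∧ ∃ j, C i j = x} 1

/-- The CES utility `(∑ⱼ (cⱼ xⱼ) ^ ρ) ^ (1 / ρ)` of a basket `x`. -/
noncomputable def cesUtility {n : ℕ} (ρ : ℝ) (c x : Fin n → ℝ) : ℝ :=
  (∑ j, (c j * x j) ^ ρ) ^ (1 / ρ)

namespace Market

variable {n : ℕ} (M : Market n)

/-! ### Demand and equilibrium -/

/-- `Pᵢ(p) = ∑ₖ Cᵢₖ / pₖ ^ δ`. -/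
noncomputable def P (δ : ℝ) (p : Fin n → ℝ) (i : Fin n) : ℝ :=
  ∑ k, M.C i k / p k ^ δ

/-- The demand `dᵢⱼ(p)` of participant `i` for good `j` at prices `p`. -/
noncomputable def demand (δ : ℝ) (p : Fin n → ℝ) (i j : Fin n) : ℝ :=
  p i * M.C i j / (p j ^ (1 + δ) * M.P δ p i)

/-- The total demand `dⱼ(p)` for good `j`. -/
noncomputable def totalDemand (δ : ℝ) (p : Fin n → ℝ) (j : Fin n) : ℝ :=
  ∑ i, M.demand δ p i j

/-- Equilibrium prices: positive prices at which the demand for every good equals its supply. -/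
def IsEquilibrium (δ : ℝ) (r : Fin n → ℝ) : Prop :=
  (∀ i, 0 < r i) ∧ ∀ j, M.totalDemand δ r j = 1

/-- The matrix `D` of the tâtonnement dynamics linearized at `r`: `D j i = ∂ dⱼ / ∂ αᵢ` at `α = 0`,
where the prices are `pₖ = rₖ exp αₖ`. -/
noncomputable def dynamicsMatrix (δ : ℝ) (r : Fin n → ℝ) : Matrix (Fin n) (Fin n) ℝ :=
  Matrix.of fun j i => deriv
    (fun t : ℝ => M.totalDemand δ (fun k => r k * Real.exp ((Pi.single i t : Fin n → ℝ) k)) j) 0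

lemma exists_C_pos (i : Fin n) : ∃ j, 0 < M.C i j := by
  obtain ⟨h0, j, hj⟩ := (M.normalized i).1
  exact ⟨j, hj ▸ h0⟩

lemma P_pos (δ : ℝ) {p : Fin n → ℝ} (hp : ∀ k, 0 < p k) (i : Fin n) : 0 < M.P δ p i := by
  obtain ⟨j, hj⟩ := M.exists_C_pos i
  refine Finset.sum_pos' (fun k _ => div_nonneg (M.nonneg i k) (Real.rpow_nonneg (hp k).le _))
    ⟨j, Finset.mem_univ _, div_pos hj (Real.rpow_pos_of_pos (hp j) _)⟩

/-- At positive prices, `demand δ p i` is the unique utility-maximizing basket within the budget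
`p i` of participant `i`, whose CES utility has exponent `ρ = δ / (1 + δ)`, that is
`δ = ρ / (1 - ρ)`, and coefficients `c i j = (C i j) ^ (1 / δ)`. -/
theorem demand_unique_optimal {δ : ℝ} (hδ : 0 < δ) {p : Fin n → ℝ} (hp : ∀ k, 0 < p k)
    (i : Fin n) :
    (∀ j, 0 ≤ M.demand δ p i j) ∧ ∑ j, p j * M.demand δ p i j = p i ∧
    ∀ x : Fin n → ℝ, (∀ j, 0 ≤ x j) → ∑ j, p j * x j ≤ p i → x ≠ M.demand δ p i →
      cesUtility (δ / (1 + δ)) (fun j => M.C i j ^ (1 / δ)) x <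
        cesUtility (δ / (1 + δ)) (fun j => M.C i j ^ (1 / δ)) (M.demand δ p i) := by
  have hP := M.P_pos δ hp i
  have hd0 : ∀ j, 0 ≤ M.demand δ p i j := fun j =>
    div_nonneg (mul_nonneg (hp i).le (M.nonneg i j))
      (mul_nonneg (Real.rpow_nonneg (hp j).le _) hP.le)
  have hbud : ∑ j, p j * M.demand δ p i j = p i := by
    have h1 : ∀ j, p j * M.demand δ p i j = p i / M.P δ p i * (M.C i j / p j ^ δ) := by
      intro j
      have h2 : p j ^ (1 + δ) = p j * p j ^ δ := by
        rw [Real.rpow_add (hp j), Real.rpow_one]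
      have h3 := (Real.rpow_pos_of_pos (hp j) δ).ne'
      have h4 := (hp j).ne'
      have h5 := hP.ne'
      rw [demand, h2]
      field_simp
    rw [Finset.sum_congr rfl fun j _ => h1 j, ← Finset.mul_sum]
    change p i / M.P δ p i * M.P δ p i = p i
    exact div_mul_cancel₀ _ hP.ne'
  refine ⟨hd0, hbud, fun x hx hxb hne => ?_⟩
  set ρ : ℝ := δ / (1 + δ) with hρ
  have h1δ : 0 < 1 + δ := by linarith
  have hρ0 : 0 < ρ := div_pos hδ h1δ
  have hρ1 : ρ < 1 := by rw [hρ, div_lt_one h1δ]; linarith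
  set m : ℝ := (p i / M.P δ p i) ^ (ρ - 1) with hm
  have hq : 0 < p i / M.P δ p i := div_pos (hp i) hP
  have hm0 : 0 < m := Real.rpow_pos_of_pos hq _
  have key : ∀ j, x j ≠ M.demand δ p i j →
      (M.C i j ^ (1 / δ) * x j) ^ ρ <
        (M.C i j ^ (1 / δ) * M.demand δ p i j) ^ ρ
          + ρ * m * (p j * x j - p j * M.demand δ p i j) := by
    intro j hj
    rcases (M.nonneg i j).eq_or_lt with h0 | hC
    · have hd : M.demand δ p i j = 0 := by simp [demand, ← h0]
      have hxj : 0 < x j := lt_of_le_of_ne (hx j) (fun h => hj (by rw [hd, ← h]))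
      have hc : M.C i j ^ (1 / δ) = 0 := by
        rw [← h0, Real.zero_rpow (one_div_pos.mpr hδ).ne']
      rw [hd, hc, zero_mul, mul_zero, mul_zero, sub_zero, Real.zero_rpow hρ0.ne', zero_add]
      exact mul_pos (mul_pos hρ0 hm0) (mul_pos (hp j) hxj)
    · set a := M.demand δ p i j with ha
      have ha0 : 0 < a :=
        div_pos (mul_pos (hp i) hC) (mul_pos (Real.rpow_pos_of_pos (hp j) _) hP)
      have hcρ : (M.C i j ^ (1 / δ)) ^ ρ = M.C i j ^ (1 - ρ) := by
        rw [← Real.rpow_mul hC.le]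
        congr 1
        rw [hρ]; field_simp; ring
      have haρ : a ^ (ρ - 1) = m * (M.C i j ^ (ρ - 1) * p j) := by
        have e : a = p i / M.P δ p i * (M.C i j * p j ^ (-(1 + δ))) := by
          rw [ha, demand, Real.rpow_neg (hp j).le]
          field_simp
        have e2 : (p j ^ (-(1 + δ))) ^ (ρ - 1) = p j := by
          rw [← Real.rpow_mul (hp j).le]
          have : -(1 + δ) * (ρ - 1) = 1 := by rw [hρ]; field_simp; ring
          rw [this, Real.rpow_one]
        have hpp := Real.rpow_pos_of_pos (hp j) (-(1 + δ))
        rw [e, Real.mul_rpow hq.le (mul_pos hC hpp).le, Real.mul_rpow hC.le hpp.le, e2]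
      have hslope : M.C i j ^ (1 - ρ) * a ^ (ρ - 1) = m * p j := by
        rw [haρ]
        have : M.C i j ^ (1 - ρ) * M.C i j ^ (ρ - 1) = 1 := by
          rw [← Real.rpow_add hC]; simp
        calc _ = (M.C i j ^ (1 - ρ) * M.C i j ^ (ρ - 1)) * (m * p j) := by ring
          _ = _ := by rw [this, one_mul]
      have htan : x j ^ ρ < a ^ ρ + ρ * a ^ (ρ - 1) * (x j - a) := by
        have hs : -1 ≤ x j / a - 1 := by
          have := div_nonneg (hx j) ha0.le
          linarith
        have hs' : x j / a - 1 ≠ 0 := by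
          intro h
          exact hj ((div_eq_one_iff_eq ha0.ne').mp (by linarith))
        have h := rpow_one_add_lt_one_add_mul_self hs hs' hρ0 hρ1
        rw [add_sub_cancel, Real.div_rpow (hx j) ha0.le] at h
        have haρ0 : 0 < a ^ ρ := Real.rpow_pos_of_pos ha0 _
        rw [div_lt_iff₀ haρ0] at h
        have e : a ^ ρ = a ^ (ρ - 1) * a := by
          rw [← Real.rpow_add_one ha0.ne']; simp
        calc x j ^ ρ < (1 + ρ * (x j / a - 1)) * a ^ ρ := h
          _ = a ^ ρ + ρ * a ^ ρ * (x j / a - 1) := by ring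
          _ = a ^ ρ + ρ * (a ^ (ρ - 1) * a) * (x j / a - 1) := by rw [← e]
          _ = _ := by field_simp
      have hc0 : 0 ≤ M.C i j ^ (1 / δ) := Real.rpow_nonneg hC.le _
      rw [Real.mul_rpow hc0 (hx j), Real.mul_rpow hc0 ha0.le, hcρ]
      have hCp : 0 < M.C i j ^ (1 - ρ) := Real.rpow_pos_of_pos hC _
      calc _ < M.C i j ^ (1 - ρ) * (a ^ ρ + ρ * a ^ (ρ - 1) * (x j - a)) :=
            mul_lt_mul_of_pos_left htan hCp
        _ = M.C i j ^ (1 - ρ) * a ^ ρ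
              + ρ * (M.C i j ^ (1 - ρ) * a ^ (ρ - 1)) * (x j - a) := by ring
        _ = _ := by rw [hslope]; ring
  have hsum : ∑ j, (M.C i j ^ (1 / δ) * x j) ^ ρ <
      ∑ j, (M.C i j ^ (1 / δ) * M.demand δ p i j) ^ ρ := by
    have hlt : ∑ j, (M.C i j ^ (1 / δ) * x j) ^ ρ <
        ∑ j, ((M.C i j ^ (1 / δ) * M.demand δ p i j) ^ ρ
          + ρ * m * (p j * x j - p j * M.demand δ p i j)) := by
      obtain ⟨j, hj⟩ := Function.ne_iff.mp hne
      refine Finset.sum_lt_sum (fun k _ => ?_) ⟨j, Finset.mem_univ _, key j hj⟩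
      by_cases hk : x k = M.demand δ p i k
      · rw [hk]; simp
      · exact (key k hk).le
    rw [Finset.sum_add_distrib, ← Finset.mul_sum, Finset.sum_sub_distrib, hbud] at hlt
    have : ρ * m * (∑ j, p j * x j - p i) ≤ 0 :=
      mul_nonpos_of_nonneg_of_nonpos (mul_pos hρ0 hm0).le (by linarith)
    linarith
  exact Real.rpow_lt_rpow
    (Finset.sum_nonneg fun j _ => Real.rpow_nonneg
      (mul_nonneg (Real.rpow_nonneg (M.nonneg i j) _) (hx j)) _) hsum (one_div_pos.mpr hρ0)

/-! ### The parameters `γ` and `ψ̃` -/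

/-- `γ = maxᵢ ∑ⱼ Cᵢⱼ`. -/
noncomputable def gamma : ℝ := ⨆ i, ∑ j, M.C i j

lemma C_pos_symm {i j : Fin n} (h : 0 < M.C i j) : 0 < M.C j i := by
  obtain ⟨k, w, h0, hk, hw⟩ := M.connected j i
  let u : ℕ → Fin n := fun l => Nat.casesOn l i w
  have hu := M.circulation_free (k + 1) u hk
  rw [Finset.prod_range_succ', Finset.prod_range_succ'] at hu
  change (∏ l ∈ Finset.range k, M.C (w l) (w (l + 1))) * M.C i (w 0)
    = (∏ l ∈ Finset.range k, M.C (w (l + 1)) (w l)) * M.C (w 0) i at hu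
  rw [h0] at hu
  refine lt_of_le_of_ne (M.nonneg j i) fun h' => ?_
  rw [← h', mul_zero] at hu
  exact (mul_pos hw h).ne' hu

/-- `w 0, …, w k` is a path from `i` to `j` in the market graph. -/
def IsPath (i j : Fin n) (k : ℕ) (w : ℕ → Fin n) : Prop :=
  w 0 = i ∧ w k = j ∧ ∀ l < k, 0 < M.C (w l) (w (l + 1))

lemma exists_isPath (i j : Fin n) : ∃ kw : ℕ × (ℕ → Fin n), M.IsPath i j kw.1 kw.2 := by
  obtain ⟨k, w, h0, hk, hw⟩ := M.connected i j
  refine ⟨(k, w), h0, hk, fun l hl => lt_of_le_of_ne (M.nonneg _ _) fun h => ?_⟩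
  exact hw.ne' (Finset.prod_eq_zero (Finset.mem_range.mpr hl) h.symm)

/-- The product of the ratios `C a b / C b a` over the steps `(a, b)` of a path. -/
noncomputable def pathRatio (k : ℕ) (w : ℕ → Fin n) : ℝ :=
  ∏ l ∈ Finset.range k, M.C (w l) (w (l + 1)) / M.C (w (l + 1)) (w l)

/-- `ψ i j`: the ratio `pathRatio` of a path from `i` to `j`; it does not depend on the path, see
`Market.psi_eq`. -/
noncomputable def psi (i j : Fin n) : ℝ :=
  M.pathRatio (M.exists_isPath i j).choose.1 (M.exists_isPath i j).choose.2

lemma pathRatio_pos {i j : Fin n} {k : ℕ} {w : ℕ → Fin n} (h : M.IsPath i j k w) :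
    0 < M.pathRatio k w :=
  Finset.prod_pos fun l hl =>
    div_pos (h.2.2 l (Finset.mem_range.mp hl)) (M.C_pos_symm (h.2.2 l (Finset.mem_range.mp hl)))

lemma pathRatio_closed {i : Fin n} {k : ℕ} {w : ℕ → Fin n} (h : M.IsPath i i k w) :
    M.pathRatio k w = 1 := by
  rw [pathRatio, Finset.prod_div_distrib, M.circulation_free k w (h.2.1.trans h.1.symm)]
  refine div_self (Finset.prod_pos fun l hl => ?_).ne'
  exact M.C_pos_symm (h.2.2 l (Finset.mem_range.mp hl))

lemma exists_concat {a b c : Fin n} {k m : ℕ} {w v : ℕ → Fin n} (hw : M.IsPath a b k w)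
    (hv : M.IsPath b c m v) :
    ∃ u, M.IsPath a c (k + m) u ∧ M.pathRatio (k + m) u = M.pathRatio k w * M.pathRatio m v := by
  let u : ℕ → Fin n := fun l => if l ≤ k then w l else v (l - k)
  have u1 : ∀ l, l ≤ k → u l = w l := fun l hl => if_pos hl
  have u2 : ∀ l, u (k + l) = v l := by
    intro l
    rcases Nat.eq_zero_or_pos l with rfl | hl
    · rw [add_zero, u1 k le_rfl, hw.2.1, hv.1]
    · have : ¬ k + l ≤ k := by omega
      simp [u, this]
  refine ⟨u, ⟨(u1 0 (Nat.zero_le _)).trans hw.1, (u2 m).trans hv.2.1, fun l hl => ?_⟩, ?_⟩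
  · rcases lt_or_ge l k with h | h
    · rw [u1 l h.le, u1 (l + 1) h]
      exact hw.2.2 l h
    · obtain ⟨s, rfl⟩ := Nat.exists_eq_add_of_le h
      rw [add_assoc, u2, u2]
      exact hv.2.2 s (by omega)
  · rw [pathRatio, Finset.prod_range_add]
    congr 1
    · refine Finset.prod_congr rfl fun l hl => ?_
      have h := Finset.mem_range.mp hl
      rw [u1 l h.le, u1 (l + 1) h]
    · refine Finset.prod_congr rfl fun l _ => ?_
      rw [add_assoc, u2, u2]

/-- `ψ i j` can be computed along any path from `i` to `j`. -/
lemma psi_eq {i j : Fin n} {k : ℕ} {w : ℕ → Fin n} (h : M.IsPath i j k w) :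
    M.psi i j = M.pathRatio k w := by
  have hc := (M.exists_isPath i j).choose_spec
  obtain ⟨⟨m, v⟩, hv⟩ := M.exists_isPath j i
  obtain ⟨u, hu, e⟩ := M.exists_concat hc hv
  obtain ⟨u', hu', e'⟩ := M.exists_concat h hv
  rw [M.pathRatio_closed hu] at e
  rw [M.pathRatio_closed hu', e] at e'
  exact mul_right_cancel₀ (M.pathRatio_pos hv).ne' e'

lemma psi_mul (a b c : Fin n) : M.psi a b * M.psi b c = M.psi a c := by
  obtain ⟨⟨k, w⟩, hw⟩ := M.exists_isPath a b
  obtain ⟨⟨m, v⟩, hv⟩ := M.exists_isPath b c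
  obtain ⟨u, hu, e⟩ := M.exists_concat hw hv
  rw [M.psi_eq hw, M.psi_eq hv, M.psi_eq hu, e]

/-- There is a vertex `i₀` with `ψ i₀ j ≥ 1` for all `j`. -/
lemma exists_base : ∃ i₀, ∀ j, 1 ≤ M.psi i₀ j := by
  have : NeZero n := ⟨by have := M.two_le; omega⟩
  obtain ⟨i₀, h⟩ := Finite.exists_min (M.psi (0 : Fin n))
  refine ⟨i₀, fun j => ?_⟩
  have hpos : 0 < M.psi 0 i₀ := M.pathRatio_pos (M.exists_isPath 0 i₀).choose_spec
  have h1 := h j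
  rw [← M.psi_mul 0 i₀ j] at h1
  exact (le_mul_iff_one_le_right hpos).mp h1

/-- `ψ̃ = maxⱼ ψ i₀ j`, where `i₀` is such that `ψ i₀ j ≥ 1` for all `j`. -/
noncomputable def psiTilde : ℝ := ⨆ j, M.psi M.exists_base.choose j

/-! ### The weighted graphs `U` and `E` -/

open Classical in
/-- The adjacency matrix of the unweighted market graph. -/
noncomputable def U : Matrix (Fin n) (Fin n) ℝ :=
  Matrix.of fun i j => if 0 < M.C i j then 1 else 0

open Classical in
/-- The market graph with weight `√(rᵢ rⱼ)` on each edge. -/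
noncomputable def E (r : Fin n → ℝ) : Matrix (Fin n) (Fin n) ℝ :=
  Matrix.of fun i j => if 0 < M.C i j then √(r i * r j) else 0

end Market

/-- The normalized Laplacian `I - a⁻¹ A a⁻¹` of a weighted graph `A`, where `a` is the diagonal
matrix with entries `√(∑ⱼ Aᵢⱼ)`. -/
noncomputable def lap {n : ℕ} (A : Matrix (Fin n) (Fin n) ℝ) : Matrix (Fin n) (Fin n) ℝ :=
  1 - (Matrix.diagonal fun i => (√(∑ j, A i j))⁻¹) * A *
    Matrix.diagonal fun i => (√(∑ j, A i j))⁻¹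

/-- `λ↑ₖ(A)`, the `k`-th smallest real eigenvalue of `A` with algebraic multiplicity, `k ≥ 1`. -/
noncomputable def eigUp {n : ℕ} (k : ℕ) (A : Matrix (Fin n) (Fin n) ℝ) : ℝ :=
  (A.charpoly.roots.sort (· ≤ ·)).getD (k - 1) 0

/-- `λ↓ₖ(A)`, the `k`-th largest real eigenvalue of `A` with algebraic multiplicity, `k ≥ 1`. -/
noncomputable def eigDown {n : ℕ} (k : ℕ) (A : Matrix (Fin n) (Fin n) ℝ) : ℝ :=
  (A.charpoly.roots.sort (· ≥ ·)).getD (k - 1) 0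

/-- `q(δ, x) = -(1 + 2 δ) x + δ x²`. -/
def qPoly (δ x : ℝ) : ℝ := -(1 + 2 * δ) * x + δ * x ^ 2

open Matrix

/-! Let B be the spending matrix at equilibrium, with entry (i, j) the amount that i spends on good
j. Its i-th row sums to the income `r i`, and by market clearing so does its i-th column. Absence of
circulation makes `potential i * C i j` symmetric, so B is a symmetric matrix G times a positive
factor y depending only on the row. Equality of row and column sums says that y is harmonic for G;
by the maximum principle y is constant and B is symmetric (`price_eq`, `spending_symm`).

Differentiating the demand then gives D = W - (1 + δ) I + δ W², where W is the random walk matrix of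
B. With L = I - W this is q(δ, L), and L is similar to Lap(B). Hence D has the real eigenvalues q(δ,
v), where v runs over the spectrum of Lap(B), contained in [0, 2] and containing 0. Since q is
convex with q(0) = 0 and q(2) = -2, the largest eigenvalue of D is 0, and the second largest is
controlled by the spectral gap of Lap(B) (`eigDown_two_bounds`).

It remains to compare B with U and E. If m A ≤ B ≤ K A entrywise, Rayleigh quotients show that the
spectral gaps differ by a factor of at most K / m (`eigUp_two_le`). The bounds -δ log γ ≤ log `relP`
≤ (1 + δ) log γ yield E / γ^(1+δ) ≤ B ≤ E, and also bound all price ratios by ψ̃ γ, which turns the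
comparison with E into one with U. -/

/-! ### Second entry of a sorted list of eigenvalues -/

/-- Splitting off i and j leaves a multiset dominated by both, so sorting puts them in front.
Position 1 exists, so the default value 0 is never returned. The relation s allows both increasing
and decreasing order. -/
lemma sort_map_getD_one {n : ℕ} (s : ℝ → ℝ → Prop) [DecidableRel s] [IsTrans ℝ s]
    [Std.Antisymm s] [Std.Total s] (f : Fin n → ℝ) {i j : Fin n} (hij : i ≠ j)
    (hi : ∀ k, s (f i) (f k)) (hj : ∀ k, k ≠ i → s (f j) (f k)) :
    (((Finset.univ : Finset (Fin n)).val.map f).sort s).getD 1 0 = f j := by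
  have h1 : (Finset.univ : Finset (Fin n)).val.map f =
      f i ::ₘ f j ::ₘ (((Finset.univ.erase i).erase j).val.map f) := by
    rw [← Multiset.map_cons, ← Multiset.map_cons]
    congr 1
    rw [← Finset.insert_val_of_notMem (by simp), Finset.insert_erase (by simp [hij.symm]),
      ← Finset.insert_val_of_notMem (by simp), Finset.insert_erase (by simp)]
  rw [h1, Multiset.sort_cons, Multiset.sort_cons]
  · rfl
  · intro b hb
    obtain ⟨k, hk, rfl⟩ := Multiset.mem_map.mp hb
    exact hj k (Finset.ne_of_mem_erase (Finset.mem_of_mem_erase (Finset.mem_val.mp hk)))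
  · intro b hb
    rw [← Multiset.map_cons] at hb
    obtain ⟨k, hk, rfl⟩ := Multiset.mem_map.mp hb
    exact hi k

lemma exists_two_minima {n : ℕ} (hn : 2 ≤ n) (f : Fin n → ℝ) :
    ∃ i j, i ≠ j ∧ (∀ k, f i ≤ f k) ∧ ∀ k, k ≠ i → f j ≤ f k := by
  have : NeZero n := ⟨by omega⟩
  obtain ⟨i, hi⟩ := Finite.exists_min f
  have : Nontrivial (Fin n) := Fin.nontrivial_iff_two_le.mpr hn
  obtain ⟨k, hk⟩ := exists_ne i
  obtain ⟨j, hj, h⟩ := Finset.exists_min_image (Finset.univ.erase i) f ⟨k, by simp [hk]⟩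
  exact ⟨i, j, (Finset.ne_of_mem_erase hj).symm, hi, fun l hl => h l (by simp [hl])⟩

/-! ### Orthogonal diagonalization and Rayleigh quotients -/

/-- An orthogonal diagonalization of a real matrix. -/
structure Matrix.OrthoDiag {n : ℕ} (S V : Matrix (Fin n) (Fin n) ℝ) (v : Fin n → ℝ) : Prop where
  left : V.transpose * V = 1
  right : V * V.transpose = 1
  eq : S = V * Matrix.diagonal v * V.transpose

lemma Matrix.IsSymm.exists_orthoDiag {n : ℕ} {S : Matrix (Fin n) (Fin n) ℝ} (hS : S.IsSymm) :
    ∃ V v, S.OrthoDiag V v := by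
  have hH : S.IsHermitian := by
    rw [Matrix.IsHermitian, Matrix.conjTranspose_eq_transpose_of_trivial]; exact hS
  have ht : star (hH.eigenvectorUnitary : Matrix (Fin n) (Fin n) ℝ) =
      (hH.eigenvectorUnitary : Matrix (Fin n) (Fin n) ℝ)ᵀ := by
    rw [Matrix.star_eq_conjTranspose, Matrix.conjTranspose_eq_transpose_of_trivial]
  refine ⟨hH.eigenvectorUnitary, hH.eigenvalues, ?_, ?_, ?_⟩
  · rw [← ht]; exact Unitary.coe_star_mul_self _
  · rw [← ht]; exact Unitary.coe_mul_star_self _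
  · rw [← ht]
    have := hH.spectral_theorem
    simpa [Unitary.conjStarAlgAut_apply, Function.comp_def] using this

lemma charpoly_conj {n : ℕ} {V V' : Matrix (Fin n) (Fin n) ℝ} (h : V * V' = 1)
    (A : Matrix (Fin n) (Fin n) ℝ) : (V * A * V').charpoly = A.charpoly := by
  have h' : V' * V = 1 := mul_eq_one_comm.mp h
  rw [Matrix.charpoly_mul_comm, ← Matrix.mul_assoc, h', Matrix.one_mul]

lemma charpoly_conj_diagonal {n : ℕ} {V V' : Matrix (Fin n) (Fin n) ℝ} (h : V * V' = 1)
    (f : Fin n → ℝ) : (V * Matrix.diagonal f * V').charpoly =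
      ∏ k, (Polynomial.X - Polynomial.C (f k)) := by
  rw [charpoly_conj h, Matrix.charpoly_diagonal]

lemma roots_prod_X_sub_C_univ {n : ℕ} (f : Fin n → ℝ) :
    (∏ k, (Polynomial.X - Polynomial.C (f k))).roots = Finset.univ.val.map f := by
  rw [Polynomial.roots_prod _ _
    (Finset.prod_ne_zero_iff.mpr fun k _ => Polynomial.X_sub_C_ne_zero _)]
  simp

namespace Matrix.OrthoDiag

variable {n : ℕ} {S V : Matrix (Fin n) (Fin n) ℝ} {v : Fin n → ℝ}

lemma eigUp_two (h : S.OrthoDiag V v) {i j : Fin n} (hij : i ≠ j)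
    (hi : ∀ k, v i ≤ v k) (hj : ∀ k, k ≠ i → v j ≤ v k) : eigUp 2 S = v j := by
  rw [eigUp, h.eq, charpoly_conj_diagonal h.right, roots_prod_X_sub_C_univ]
  exact sort_map_getD_one _ v hij hi hj

lemma quad (h : S.OrthoDiag V v) (x : Fin n → ℝ) :
    x ⬝ᵥ S *ᵥ x = ∑ k, v k * (V.transpose *ᵥ x) k ^ 2 := by
  rw [h.eq, ← Matrix.mulVec_mulVec, ← Matrix.mulVec_mulVec, Matrix.dotProduct_mulVec,
    ← Matrix.mulVec_transpose]
  simp only [dotProduct, Matrix.mulVec_diagonal]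
  exact Finset.sum_congr rfl fun k _ => by ring

lemma norm_sq (h : S.OrthoDiag V v) (x : Fin n → ℝ) :
    x ⬝ᵥ x = ∑ k, (V.transpose *ᵥ x) k ^ 2 := by
  have : x ⬝ᵥ x = x ⬝ᵥ (V * V.transpose) *ᵥ x := by rw [h.right, Matrix.one_mulVec]
  rw [this, ← Matrix.mulVec_mulVec, Matrix.dotProduct_mulVec, ← Matrix.mulVec_transpose]
  simp only [dotProduct]
  exact Finset.sum_congr rfl fun k _ => by ring

lemma transpose_mulVec_mulVec (h : S.OrthoDiag V v) (z : Fin n → ℝ) :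
    V.transpose *ᵥ (V *ᵥ z) = z := by
  rw [Matrix.mulVec_mulVec, h.left, Matrix.one_mulVec]

lemma le_eigenvalue (h : S.OrthoDiag V v) {t : ℝ} (ht : ∀ x, t * (x ⬝ᵥ x) ≤ x ⬝ᵥ S *ᵥ x)
    (k : Fin n) : t ≤ v k := by
  have := ht (V *ᵥ Pi.single k 1)
  rw [h.quad, h.norm_sq, h.transpose_mulVec_mulVec] at this
  simpa [Pi.single_apply] using this

lemma eigenvalue_le (h : S.OrthoDiag V v) {t : ℝ} (ht : ∀ x, x ⬝ᵥ S *ᵥ x ≤ t * (x ⬝ᵥ x))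
    (k : Fin n) : v k ≤ t := by
  have := ht (V *ᵥ Pi.single k 1)
  rw [h.quad, h.norm_sq, h.transpose_mulVec_mulVec] at this
  simpa [Pi.single_apply] using this

/-- The upper half of Courant–Fischer: a plane contains a nonzero vector orthogonal to the i-th
eigenvector, and there the Rayleigh quotient is at least `v j`. -/
lemma le_of_plane (h : S.OrthoDiag V v) {i j : Fin n} (hj : ∀ k, k ≠ i → v j ≤ v k)
    {t : ℝ} (x y : Fin n → ℝ) (hxy : ∀ a b : ℝ, a • x + b • y = 0 → a = 0 ∧ b = 0)
    (ht : ∀ a b : ℝ, (a • x + b • y) ⬝ᵥ S *ᵥ (a • x + b • y) ≤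
      t * ((a • x + b • y) ⬝ᵥ (a • x + b • y))) : v j ≤ t := by
  obtain ⟨a, b, hab, h0⟩ : ∃ a b : ℝ, ¬ (a = 0 ∧ b = 0) ∧
      (V.transpose *ᵥ (a • x + b • y)) i = 0 := by
    simp only [Matrix.mulVec_add, Matrix.mulVec_smul, Pi.add_apply, Pi.smul_apply, smul_eq_mul]
    -- The coefficients are chosen to cancel the i-th coordinates of x and y.
    by_cases hx : (V.transpose *ᵥ x) i = 0
    · exact ⟨1, 0, by simp, by simp [hx]⟩
    · exact ⟨-(V.transpose *ᵥ y) i, (V.transpose *ᵥ x) i, fun H => hx H.2, by ring⟩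
  have hne : a • x + b • y ≠ 0 := fun H => hab (hxy a b H)
  set g := a • x + b • y
  have hg := ht a b
  change g ⬝ᵥ S *ᵥ g ≤ t * (g ⬝ᵥ g) at hg
  have hpos : 0 < g ⬝ᵥ g :=
    lt_of_le_of_ne (Finset.sum_nonneg fun k _ => mul_self_nonneg _)
      (fun H => hne (dotProduct_self_eq_zero.mp H.symm))
  have hlow : v j * (g ⬝ᵥ g) ≤ g ⬝ᵥ S *ᵥ g := by
    rw [h.quad, h.norm_sq, Finset.mul_sum]
    refine Finset.sum_le_sum fun k _ => ?_
    by_cases hk : k = i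
    · rw [hk, h0]; simp
    · exact mul_le_mul_of_nonneg_right (hj k hk) (sq_nonneg _)
  exact le_of_mul_le_mul_right (hlow.trans hg) hpos

/-- The span of the i-th and j-th eigenvectors is the test plane to be fed, after transport to
another graph, into `le_of_plane`. -/
lemma plane_le (h : S.OrthoDiag V v) {i j : Fin n} (hij : i ≠ j) (hi : v i ≤ v j) (a b : ℝ) :
    (a • (V *ᵥ Pi.single i 1) + b • (V *ᵥ Pi.single j 1)) ⬝ᵥ
        S *ᵥ (a • (V *ᵥ Pi.single i 1) + b • (V *ᵥ Pi.single j 1)) ≤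
      v j * ((a • (V *ᵥ Pi.single i 1) + b • (V *ᵥ Pi.single j 1)) ⬝ᵥ
        (a • (V *ᵥ Pi.single i 1) + b • (V *ᵥ Pi.single j 1))) := by
  rw [h.quad, h.norm_sq, Finset.mul_sum]
  simp only [Matrix.mulVec_add, Matrix.mulVec_smul, h.transpose_mulVec_mulVec]
  refine Finset.sum_le_sum fun k _ => ?_
  by_cases hk : k = i
  · subst hk; exact mul_le_mul_of_nonneg_right hi (sq_nonneg _)
  by_cases hk' : k = j
  · subst hk'; exact le_rfl
  · simp [hk, hk']

lemma plane_injective (h : S.OrthoDiag V v) {i j : Fin n} (hij : i ≠ j) (a b : ℝ)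
    (h0 : a • (V *ᵥ Pi.single i 1) + b • (V *ᵥ Pi.single j 1) = 0) : a = 0 ∧ b = 0 := by
  have := congrArg (fun z => V.transpose *ᵥ z) h0
  simp only [Matrix.mulVec_add, Matrix.mulVec_smul, h.transpose_mulVec_mulVec,
    Matrix.mulVec_zero] at this
  have hi := congrFun this i
  have hj := congrFun this j
  simp [hij, hij.symm] at hi hj
  exact ⟨hi, hj⟩

end Matrix.OrthoDiag

/-! ### Normalized Laplacians of weighted graphs -/

/-- A weighted graph: a symmetric nonnegative matrix without zero rows. -/
structure IsWeightedGraph {n : ℕ} (A : Matrix (Fin n) (Fin n) ℝ) : Prop where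
  symm : ∀ i j, A i j = A j i
  nonneg : ∀ i j, 0 ≤ A i j
  row_pos : ∀ i, 0 < ∑ j, A i j

namespace IsWeightedGraph

variable {n : ℕ} {A B : Matrix (Fin n) (Fin n) ℝ}

lemma lap_apply (A : Matrix (Fin n) (Fin n) ℝ) (i j : Fin n) : lap A i j =
    (1 : Matrix (Fin n) (Fin n) ℝ) i j - (√(∑ k, A i k))⁻¹ * A i j * (√(∑ k, A j k))⁻¹ := by
  simp [lap, Matrix.mul_diagonal, Matrix.diagonal_mul]

lemma lap_isSymm (hA : IsWeightedGraph A) : (lap A).IsSymm := by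
  ext i j
  rw [Matrix.transpose_apply, lap_apply, lap_apply, hA.symm i j,
    ← Matrix.transpose_apply (1 : Matrix (Fin n) (Fin n) ℝ), Matrix.transpose_one]
  ring

lemma scaled_norm_sq (hA : IsWeightedGraph A) (f : Fin n → ℝ) :
    (fun i => √(∑ j, A i j) * f i) ⬝ᵥ (fun i => √(∑ j, A i j) * f i) =
      ∑ i, (∑ j, A i j) * f i ^ 2 := by
  refine Finset.sum_congr rfl fun i _ => ?_
  have := Real.mul_self_sqrt (hA.row_pos i).le
  linear_combination (f i) ^ 2 * this

/-- Substituting x = √degree · f removes the normalization, so that the quadratic form and the norm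
are both linear in the weights; this is what makes different graphs comparable. -/
lemma scaled_lap (hA : IsWeightedGraph A) (f : Fin n → ℝ) :
    (fun i => √(∑ j, A i j) * f i) ⬝ᵥ lap A *ᵥ (fun i => √(∑ j, A i j) * f i) =
      ∑ i, (∑ j, A i j) * f i ^ 2 - ∑ i, ∑ j, A i j * (f i * f j) := by
  have h0 : ∀ i, √(∑ j, A i j) ≠ 0 := fun i => (Real.sqrt_pos.mpr (hA.row_pos i)).ne'
  have h1 : lap A *ᵥ (fun i => √(∑ j, A i j) * f i) =
      (fun i => √(∑ j, A i j) * f i) - fun i => (√(∑ j, A i j))⁻¹ * ∑ j, A i j * f j := by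
    have : lap A = 1 - Matrix.of fun i j => (√(∑ k, A i k))⁻¹ * A i j * (√(∑ k, A j k))⁻¹ := by
      ext i j; rw [lap_apply]; rfl
    rw [this, Matrix.sub_mulVec, Matrix.one_mulVec]
    congr 1
    ext i
    simp only [Matrix.mulVec, dotProduct, Matrix.of_apply]
    rw [Finset.mul_sum]
    refine Finset.sum_congr rfl fun j _ => ?_
    have := h0 j
    field_simp
  rw [h1, dotProduct_sub, hA.scaled_norm_sq]
  congr 1
  refine Finset.sum_congr rfl fun i _ => ?_
  dsimp only
  have := h0 i
  rw [mul_comm (√(∑ j, A i j)), mul_assoc, mul_inv_cancel_left₀ this, Finset.mul_sum]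
  exact Finset.sum_congr rfl fun j _ => by ring

lemma sum_sq_sub (hA : IsWeightedGraph A) (f : Fin n → ℝ) :
    ∑ i, (∑ j, A i j) * f i ^ 2 - ∑ i, ∑ j, A i j * (f i * f j) =
      (∑ i, ∑ j, A i j * (f i - f j) ^ 2) / 2 := by
  have h2 : ∑ i, (∑ j, A i j) * f i ^ 2 = ∑ i, ∑ j, A i j * f j ^ 2 := by
    rw [Finset.sum_comm]
    refine Finset.sum_congr rfl fun i _ => ?_
    rw [Finset.sum_mul]
    exact Finset.sum_congr rfl fun j _ => by rw [hA.symm]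
  have h1 : ∑ i, (∑ j, A i j) * f i ^ 2 = ∑ i, ∑ j, A i j * f i ^ 2 :=
    Finset.sum_congr rfl fun i _ => Finset.sum_mul ..
  have h3 : ∑ i, ∑ j, A i j * (f i - f j) ^ 2 = ∑ i, ∑ j, A i j * f i ^ 2 +
      ∑ i, ∑ j, A i j * f j ^ 2 - 2 * ∑ i, ∑ j, A i j * (f i * f j) := by
    simp only [Finset.mul_sum, ← Finset.sum_add_distrib, ← Finset.sum_sub_distrib]
    exact Finset.sum_congr rfl fun i _ => Finset.sum_congr rfl fun j _ => by ring
  rw [h3, ← h1, ← h2]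
  ring

/-- Expand the nonnegative sum of `A i j * (f i + f j) ^ 2`; this is the source of the bound 2 on
the spectrum. -/
lemma neg_sum_le (hA : IsWeightedGraph A) (f : Fin n → ℝ) :
    -∑ i, ∑ j, A i j * (f i * f j) ≤ ∑ i, (∑ j, A i j) * f i ^ 2 := by
  have h2 : ∑ i, (∑ j, A i j) * f i ^ 2 = ∑ i, ∑ j, A i j * f j ^ 2 := by
    rw [Finset.sum_comm]
    refine Finset.sum_congr rfl fun i _ => ?_
    rw [Finset.sum_mul]
    exact Finset.sum_congr rfl fun j _ => by rw [hA.symm]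
  have h1 : ∑ i, (∑ j, A i j) * f i ^ 2 = ∑ i, ∑ j, A i j * f i ^ 2 :=
    Finset.sum_congr rfl fun i _ => Finset.sum_mul ..
  have h3 : ∑ i, ∑ j, A i j * (f i + f j) ^ 2 = ∑ i, ∑ j, A i j * f i ^ 2 +
      ∑ i, ∑ j, A i j * f j ^ 2 + 2 * ∑ i, ∑ j, A i j * (f i * f j) := by
    simp only [Finset.mul_sum, ← Finset.sum_add_distrib]
    exact Finset.sum_congr rfl fun i _ => Finset.sum_congr rfl fun j _ => by ring
  have h4 : 0 ≤ ∑ i, ∑ j, A i j * (f i + f j) ^ 2 :=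
    Finset.sum_nonneg fun i _ => Finset.sum_nonneg fun j _ =>
      mul_nonneg (hA.nonneg i j) (sq_nonneg _)
  rw [h3, ← h1, ← h2] at h4
  linarith

lemma eq_scaled (hA : IsWeightedGraph A) (x : Fin n → ℝ) :
    x = fun i => √(∑ j, A i j) * (x i / √(∑ j, A i j)) := by
  ext i
  rw [mul_div_cancel₀ _ (Real.sqrt_pos.mpr (hA.row_pos i)).ne']

lemma eigenvalue_nonneg (hA : IsWeightedGraph A) {V : Matrix (Fin n) (Fin n) ℝ} {v : Fin n → ℝ}
    (h : (lap A).OrthoDiag V v) (k : Fin n) : 0 ≤ v k := by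
  refine h.le_eigenvalue (fun x => ?_) k
  rw [hA.eq_scaled x, hA.scaled_lap, hA.sum_sq_sub, zero_mul]
  exact div_nonneg (Finset.sum_nonneg fun i _ => Finset.sum_nonneg fun j _ =>
      mul_nonneg (hA.nonneg i j) (sq_nonneg _)) zero_le_two

lemma eigenvalue_le_two (hA : IsWeightedGraph A) {V : Matrix (Fin n) (Fin n) ℝ} {v : Fin n → ℝ}
    (h : (lap A).OrthoDiag V v) (k : Fin n) : v k ≤ 2 := by
  refine h.eigenvalue_le (fun x => ?_) k
  rw [hA.eq_scaled x, hA.scaled_lap, hA.scaled_norm_sq]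
  linarith [hA.neg_sum_le fun i => x i / √(∑ j, A i j)]

lemma least_eigenvalue_eq_zero (hA : IsWeightedGraph A)
    {V : Matrix (Fin n) (Fin n) ℝ} {v : Fin n → ℝ}
    (h : (lap A).OrthoDiag V v) {i : Fin n} (hi : ∀ k, v i ≤ v k) : v i = 0 := by
  refine le_antisymm ?_ (hA.eigenvalue_nonneg h i)
  -- The constant function has zero energy, so √degree is a null vector of the quadratic form.
  have h0 := hA.scaled_lap (fun _ => 1)
  rw [hA.sum_sq_sub] at h0
  simp only [sub_self, ne_eq, OfNat.ofNat_ne_zero, not_false_eq_true, zero_pow, mul_zero,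
    Finset.sum_const_zero, zero_div] at h0
  set x : Fin n → ℝ := fun i => √(∑ j, A i j) * 1 with hx
  have hpos : 0 < x ⬝ᵥ x := by
    rw [hA.scaled_norm_sq]
    have : Nonempty (Fin n) := ⟨i⟩
    refine Finset.sum_pos (fun k _ => ?_) Finset.univ_nonempty
    simpa using hA.row_pos k
  have : v i * (x ⬝ᵥ x) ≤ 0 := by
    rw [← h0, h.quad, h.norm_sq, Finset.mul_sum]
    exact Finset.sum_le_sum fun k _ => mul_le_mul_of_nonneg_right (hi k) (sq_nonneg _)
  by_contra hc
  push Not at hc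
  exact absurd this (mul_pos hc hpos).not_ge

/-- The trace is at most n because the diagonal of A is nonnegative, while n - 1 of the nonnegative
eigenvalues are at least `v j`. Hence `v j` ≤ n / (n - 1). -/
lemma second_eigenvalue_le (hA : IsWeightedGraph A) (hn : 2 ≤ n)
    {V : Matrix (Fin n) (Fin n) ℝ} {v : Fin n → ℝ} (h : (lap A).OrthoDiag V v) {i j : Fin n}
    (hj : ∀ k, k ≠ i → v j ≤ v k) : v j ≤ 1 + 1 / ((n : ℝ) - 1) := by
  have htr : (lap A).trace = ∑ k, v k := by
    rw [h.eq, Matrix.trace_mul_comm, ← Matrix.mul_assoc, h.left, Matrix.one_mul,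
      Matrix.trace_diagonal]
  have htr' : (lap A).trace ≤ n := by
    have : (lap A).trace ≤ ∑ _k : Fin n, (1 : ℝ) := by
      refine Finset.sum_le_sum fun k _ => ?_
      rw [Matrix.diag_apply, lap_apply, Matrix.one_apply_eq]
      have := mul_nonneg (mul_nonneg (inv_nonneg.mpr (Real.sqrt_nonneg (∑ j, A k j)))
        (hA.nonneg k k)) (inv_nonneg.mpr (Real.sqrt_nonneg (∑ j, A k j)))
      linarith
    simpa using this
  have hsum : ((n : ℝ) - 1) * v j ≤ ∑ k, v k := by
    rw [← Finset.add_sum_erase _ _ (Finset.mem_univ i)]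
    have h1 : ∑ _k ∈ Finset.univ.erase i, v j ≤ ∑ k ∈ Finset.univ.erase i, v k :=
      Finset.sum_le_sum fun k hk => hj k (Finset.ne_of_mem_erase hk)
    rw [Finset.sum_const, Finset.card_erase_of_mem (Finset.mem_univ i), Finset.card_univ,
      Fintype.card_fin, nsmul_eq_mul, Nat.cast_pred (by omega)] at h1
    linarith [hA.eigenvalue_nonneg h i]
  have hn1 : 0 < (n : ℝ) - 1 := by
    have : (2 : ℝ) ≤ n := by exact_mod_cast hn
    linarith
  have : v j ≤ n / ((n : ℝ) - 1) := by
    rw [le_div_iff₀ hn1]; linarith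
  refine this.trans_eq ?_
  field_simp
  ring

lemma eigUp_two_nonneg (hA : IsWeightedGraph A) (hn : 2 ≤ n) : 0 ≤ eigUp 2 (lap A) := by
  obtain ⟨V, v, h⟩ := hA.lap_isSymm.exists_orthoDiag
  obtain ⟨i, j, hij, hi, hj⟩ := exists_two_minima hn v
  rw [h.eigUp_two hij hi hj]
  exact hA.eigenvalue_nonneg h j

/-- Comparison of the spectral gaps of weighted graphs with comparable weights. -/
lemma eigUp_two_le (hA : IsWeightedGraph A) (hB : IsWeightedGraph B) (hn : 2 ≤ n) {m K : ℝ}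
    (hm : 0 < m) (hK : 0 ≤ K) (hmA : ∀ i j, m * A i j ≤ B i j) (hKA : ∀ i j, B i j ≤ K * A i j) :
    eigUp 2 (lap B) ≤ K / m * eigUp 2 (lap A) := by
  have h0 := hA.eigUp_two_nonneg hn
  obtain ⟨V, v, h⟩ := hA.lap_isSymm.exists_orthoDiag
  obtain ⟨i, j, hij, hi, hj⟩ := exists_two_minima hn v
  obtain ⟨V', v', h'⟩ := hB.lap_isSymm.exists_orthoDiag
  obtain ⟨i', j', hij', hi', hj'⟩ := exists_two_minima hn v'
  rw [h.eigUp_two hij hi hj] at h0 ⊢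
  rw [h'.eigUp_two hij' hi' hj']
  -- T replaces the degree scaling of A by that of B while keeping the underlying function f, and it
  -- is invertible, so planes go to planes.
  set T : Matrix (Fin n) (Fin n) ℝ :=
    Matrix.diagonal fun k => √(∑ l, B k l) / √(∑ l, A k l) with hT
  have hTx : ∀ x, T *ᵥ x = fun k => √(∑ l, B k l) * (x k / √(∑ l, A k l)) := by
    intro x; ext k; rw [hT, Matrix.mulVec_diagonal]; ring
  have hlin : ∀ (a b : ℝ) (x y : Fin n → ℝ),
      a • (T *ᵥ x) + b • (T *ᵥ y) = T *ᵥ (a • x + b • y) := by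
    intro a b x y
    rw [Matrix.mulVec_add, Matrix.mulVec_smul, Matrix.mulVec_smul]
  refine h'.le_of_plane hj' (T *ᵥ (V *ᵥ Pi.single i 1)) (T *ᵥ (V *ᵥ Pi.single j 1)) ?_ ?_
  · intro a b hab
    rw [hlin] at hab
    refine h.plane_injective hij a b ?_
    ext k
    have := congrFun hab k
    rw [hT, Matrix.mulVec_diagonal] at this
    refine (mul_eq_zero.mp this).resolve_left (div_pos ?_ ?_).ne'
    · exact Real.sqrt_pos.mpr (hB.row_pos k)
    · exact Real.sqrt_pos.mpr (hA.row_pos k)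
  · intro a b
    have hp := h.plane_le hij (hi j) a b
    rw [hlin]
    set x := a • (V *ᵥ Pi.single i 1) + b • (V *ᵥ Pi.single j 1)
    set f : Fin n → ℝ := fun k => x k / √(∑ l, A k l) with hf
    rw [hA.eq_scaled x, hA.scaled_lap, hA.scaled_norm_sq, hA.sum_sq_sub] at hp
    rw [hTx, hB.scaled_lap, hB.scaled_norm_sq, hB.sum_sq_sub]
    -- Passing from A to B multiplies the energy by at most K and the norm by at least m.
    have e1 : ∑ i, ∑ j, B i j * (f i - f j) ^ 2 ≤ K * ∑ i, ∑ j, A i j * (f i - f j) ^ 2 := by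
      simp only [Finset.mul_sum, ← mul_assoc]
      exact Finset.sum_le_sum fun k _ => Finset.sum_le_sum fun l _ =>
        mul_le_mul_of_nonneg_right (hKA k l) (sq_nonneg _)
    have e2 : m * ∑ i, (∑ j, A i j) * f i ^ 2 ≤ ∑ i, (∑ j, B i j) * f i ^ 2 := by
      simp only [Finset.mul_sum, ← mul_assoc]
      refine Finset.sum_le_sum fun k _ => mul_le_mul_of_nonneg_right ?_ (sq_nonneg _)
      exact Finset.sum_le_sum fun l _ => hmA k l
    calc (∑ i, ∑ j, B i j * (f i - f j) ^ 2) / 2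
        ≤ K * ((∑ i, ∑ j, A i j * (f i - f j) ^ 2) / 2) := by linarith
      _ ≤ K * (v j * ∑ i, (∑ j, A i j) * f i ^ 2) := mul_le_mul_of_nonneg_left hp hK
      _ = K / m * v j * (m * ∑ i, (∑ j, A i j) * f i ^ 2) := by field_simp
      _ ≤ _ := mul_le_mul_of_nonneg_left e2 (mul_nonneg (div_nonneg hK hm.le) h0)

end IsWeightedGraph

/-! ### The polynomial q -/

/-- A convex function on [a, 2] is at most its larger endpoint value, and q(δ, 2) = -2 for every δ.
-/
lemma qPoly_le_max {δ a x : ℝ} (hδ : 0 ≤ δ) (hax : a ≤ x) (hx : x ≤ 2) :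
    qPoly δ x ≤ max (qPoly δ a) (-2) := by
  rcases hx.eq_or_lt with rfl | hx2
  · exact le_max_of_le_right (by rw [qPoly]; linarith)
  by_contra hc
  push Not at hc
  obtain ⟨h1, h2⟩ := max_lt_iff.mp hc
  -- The chord through the endpoints, with the exact convexity defect.
  have e : (2 - a) * qPoly δ x = (2 - x) * qPoly δ a + (x - a) * (-2)
      - δ * ((2 - x) * (x - a) * (2 - a)) := by
    rw [qPoly, qPoly]; ring
  have h3 := mul_lt_mul_of_pos_left h1 (sub_pos.mpr hx2)
  have h4 := mul_le_mul_of_nonneg_left h2.le (sub_nonneg.mpr hax)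
  have h5 : 0 ≤ δ * ((2 - x) * (x - a) * (2 - a)) :=
    mul_nonneg hδ (mul_nonneg (mul_nonneg (by linarith) (by linarith)) (by linarith))
  nlinarith

lemma qPoly_nonpos {δ x : ℝ} (hδ : 0 ≤ δ) (h0 : 0 ≤ x) (hx : x ≤ 2) : qPoly δ x ≤ 0 := by
  have := qPoly_le_max hδ h0 hx
  refine this.trans (max_le ?_ (by norm_num))
  simp [qPoly]

/-- The vertex of the parabola is at c = 1 + 1 / (2δ). Left of c, q decreases, so an upper bound on
x gives a lower bound on q; capping at c covers x beyond the vertex. -/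
lemma qPoly_min_le {δ a b x : ℝ} (hδ : 0 < δ) (ha : x ≤ a) (hb : x ≤ b) :
    qPoly δ (min (min a (1 + 1 / (2 * δ))) b) ≤ qPoly δ x := by
  set c := 1 + 1 / (2 * δ) with hc
  have hcδ : δ * c = δ + 1 / 2 := by rw [hc]; field_simp
  have e : ∀ y, qPoly δ y = δ * (y - c) ^ 2 - δ * c ^ 2 := by
    intro y
    rw [qPoly]
    linear_combination (2 * y) * hcδ
  rw [e, e]
  have hm : min (min a c) b ≤ c := (min_le_left _ _).trans (min_le_right _ _)
  have : (min (min a c) b - c) ^ 2 ≤ (x - c) ^ 2 := by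
    rcases le_total x c with h | h
    · have := le_min (le_min ha h) hb
      nlinarith
    · have : c ≤ min (min a c) b := le_min (le_min (h.trans ha) le_rfl) (h.trans hb)
      rw [le_antisymm hm this]
      simpa using sq_nonneg _
  have := mul_le_mul_of_nonneg_left this hδ.le
  linarith

/-! ### The spectrum of q(δ, L) for the random walk Laplacian L -/

namespace IsWeightedGraph

variable {n : ℕ} {A B : Matrix (Fin n) (Fin n) ℝ}

/-- The transition matrix of the random walk on a weighted graph. -/
noncomputable def _root_.walkMatrix (B : Matrix (Fin n) (Fin n) ℝ) : Matrix (Fin n) (Fin n) ℝ :=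
  Matrix.of fun i j => B i j / ∑ k, B i k

/-- The walk matrix need not be symmetric, but conjugating `lap B` by the diagonal matrix of √degree
gives 1 minus it. -/
lemma exists_conj_walkMatrix (hB : IsWeightedGraph B) {V : Matrix (Fin n) (Fin n) ℝ}
    {v : Fin n → ℝ} (h : (lap B).OrthoDiag V v) :
    ∃ P P' : Matrix (Fin n) (Fin n) ℝ, P * P' = 1 ∧
      walkMatrix B = 1 - P * Matrix.diagonal v * P' := by
  have h0 : ∀ i, √(∑ j, B i j) ≠ 0 := fun i => (Real.sqrt_pos.mpr (hB.row_pos i)).ne'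
  set a : Matrix (Fin n) (Fin n) ℝ := Matrix.diagonal fun i => √(∑ j, B i j) with ha
  set a' : Matrix (Fin n) (Fin n) ℝ := Matrix.diagonal fun i => (√(∑ j, B i j))⁻¹ with ha'
  have haa : a' * a = 1 := by
    rw [ha, ha', Matrix.diagonal_mul_diagonal, ← Matrix.diagonal_one]
    congr 1
    ext i
    exact inv_mul_cancel₀ (h0 i)
  refine ⟨a' * V, V.transpose * a, ?_, ?_⟩
  · rw [Matrix.mul_assoc, ← Matrix.mul_assoc V, h.right, Matrix.one_mul, haa]
  · have : a' * V * Matrix.diagonal v * (V.transpose * a) = a' * lap B * a := by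
      rw [h.eq]; simp only [Matrix.mul_assoc]
    rw [this]
    ext i j
    rw [Matrix.sub_apply, ha, ha', Matrix.mul_diagonal, Matrix.diagonal_mul, lap_apply,
      walkMatrix, Matrix.of_apply]
    have hs := Real.mul_self_sqrt (hB.row_pos i).le
    have e : B i j / ∑ k, B i k = B i j / (√(∑ k, B i k) * √(∑ k, B i k)) := by rw [hs]
    have hi := h0 i
    have hj := h0 j
    rw [e]
    by_cases hij : i = j
    · subst hij
      rw [Matrix.one_apply_eq]
      field_simp
      ring
    · rw [Matrix.one_apply_ne hij]
      field_simp
      ring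

lemma exists_conj_quadratic (hB : IsWeightedGraph B) {V : Matrix (Fin n) (Fin n) ℝ}
    {v : Fin n → ℝ} (h : (lap B).OrthoDiag V v) (δ : ℝ) :
    (walkMatrix B - (1 + δ) • (1 : Matrix (Fin n) (Fin n) ℝ)
      + δ • (walkMatrix B * walkMatrix B)).charpoly =
      ∏ k, (Polynomial.X - Polynomial.C (qPoly δ (v k))) := by
  obtain ⟨P, P', hP, hW⟩ := hB.exists_conj_walkMatrix h
  have hP' : P' * P = 1 := mul_eq_one_comm.mp hP
  set L := P * Matrix.diagonal v * P' with hL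
  have hLL : L * L = P * Matrix.diagonal (fun k => v k * v k) * P' := by
    rw [← Matrix.diagonal_mul_diagonal]
    calc L * L = P * Matrix.diagonal v * (P' * P) * Matrix.diagonal v * P' := by
          rw [hL]; simp only [Matrix.mul_assoc]
      _ = _ := by rw [hP', Matrix.mul_one]; simp only [Matrix.mul_assoc]
  have hq : Matrix.diagonal (fun k => qPoly δ (v k)) =
      (-(1 + 2 * δ)) • Matrix.diagonal v + δ • Matrix.diagonal (fun k => v k * v k) := by
    ext i j
    by_cases hij : i = j
    · subst hij; simp only [Matrix.add_apply, Matrix.smul_apply, Matrix.diagonal_apply_eq,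
        smul_eq_mul, qPoly]; ring
    · simp [hij]
  have key : walkMatrix B - (1 + δ) • (1 : Matrix (Fin n) (Fin n) ℝ)
      + δ • (walkMatrix B * walkMatrix B) = P * Matrix.diagonal (fun k => qPoly δ (v k)) * P' := by
    rw [hq, Matrix.mul_add, Matrix.add_mul, Matrix.mul_smul, Matrix.mul_smul, Matrix.smul_mul,
      Matrix.smul_mul, ← hLL, ← hL, hW]
    simp only [Matrix.sub_mul, Matrix.mul_sub, Matrix.one_mul, Matrix.mul_one]
    module
  rw [key, charpoly_conj_diagonal hP]

/-- Bounds on the second largest eigenvalue of `q(δ, L)`, where `L` is the random walk Laplacian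
of `B`, through the spectral gap of a weighted graph `A` with comparable weights. -/
lemma eigDown_two_bounds (hA : IsWeightedGraph A) (hB : IsWeightedGraph B) (hn : 2 ≤ n)
    {δ m K : ℝ} (hδ : 0 < δ) (hm : 0 < m) (hK : 0 < K) (hmA : ∀ i j, m * A i j ≤ B i j)
    (hKA : ∀ i j, B i j ≤ K * A i j) {D : Matrix (Fin n) (Fin n) ℝ}
    (hD : D = walkMatrix B - (1 + δ) • (1 : Matrix (Fin n) (Fin n) ℝ)
      + δ • (walkMatrix B * walkMatrix B)) :
    qPoly δ (min (min (K / m * eigUp 2 (lap A)) (1 + 1 / (2 * δ))) (1 + 1 / ((n : ℝ) - 1)))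
        ≤ eigDown 2 D ∧
      eigDown 2 D ≤ max (qPoly δ (eigUp 2 (lap A) / (K / m))) (-2) := by
  obtain ⟨V, v, h⟩ := hB.lap_isSymm.exists_orthoDiag
  obtain ⟨i, j, hij, hi, hj⟩ := exists_two_minima hn v
  have hup := hA.eigUp_two_le hB hn hm hK.le hmA hKA
  -- The same comparison with A and B exchanged, the constants being 1 / K and 1 / m.
  have hlow : eigUp 2 (lap A) ≤ K / m * eigUp 2 (lap B) := by
    have := hB.eigUp_two_le hA hn (inv_pos.mpr hK) (inv_nonneg.mpr hm.le)
      (fun i j => by rw [inv_mul_le_iff₀ hK]; exact hKA i j)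
      (fun i j => by rw [← div_eq_inv_mul, le_div_iff₀ hm, mul_comm]; exact hmA i j)
    rwa [inv_div_inv] at this
  rw [h.eigUp_two hij hi hj] at hup hlow
  -- Since q is not monotone on [0, 2], the second largest value of q may be attained at an index l
  -- other than j. The lower bound below tests j; the upper bound uses `v j ≤ v l ≤ 2`.
  obtain ⟨l, hl, hmax⟩ := Finset.exists_max_image (Finset.univ.erase i) (fun k => qPoly δ (v k))
    ⟨j, by simp [hij.symm]⟩
  have hvi := hB.least_eigenvalue_eq_zero h hi
  have hli : l ≠ i := Finset.ne_of_mem_erase hl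
  have hdown : eigDown 2 D = qPoly δ (v l) := by
    rw [eigDown, hD, hB.exists_conj_quadratic h, roots_prod_X_sub_C_univ]
    refine sort_map_getD_one (· ≥ ·) (fun k => qPoly δ (v k)) hli.symm (fun k => ?_)
      (fun k hk => hmax k (by simp [hk]))
    have : qPoly δ (v i) = 0 := by rw [hvi]; simp [qPoly]
    rw [this]
    exact qPoly_nonpos hδ.le (hB.eigenvalue_nonneg h k) (hB.eigenvalue_le_two h k)
  rw [hdown]
  constructor
  · exact (qPoly_min_le hδ hup (hB.second_eigenvalue_le hn h hj)).trans
      (hmax j (by simp [hij.symm]))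
  · refine qPoly_le_max hδ.le ?_ (hB.eigenvalue_le_two h l)
    refine le_trans ?_ (hj l hli)
    rwa [div_le_iff₀' (div_pos hK hm)]

end IsWeightedGraph

/-! ### The spending graph and the linearized dynamics -/

namespace Market

variable {n : ℕ} (M : Market n)

/-- The potential `ψ i₀ i`, which makes `potential i * C i j` symmetric. -/
noncomputable def potential (i : Fin n) : ℝ := M.psi M.exists_base.choose i

lemma one_le_potential (i : Fin n) : 1 ≤ M.potential i := M.exists_base.choose_spec i

lemma potential_pos (i : Fin n) : 0 < M.potential i := one_pos.trans_le (M.one_le_potential i)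

lemma potential_le_psiTilde (i : Fin n) : M.potential i ≤ M.psiTilde :=
  le_ciSup (f := M.potential) (Set.finite_range _).bddAbove i

lemma sum_C_le_gamma (i : Fin n) : ∑ j, M.C i j ≤ M.gamma :=
  le_ciSup (f := fun i => ∑ j, M.C i j) (Set.finite_range _).bddAbove i

lemma one_le_C {i j : Fin n} (h : 0 < M.C i j) : 1 ≤ M.C i j :=
  (M.normalized i).2 ⟨h, j, rfl⟩

lemma one_le_gamma : 1 ≤ M.gamma := by
  have i : Fin n := ⟨0, by have := M.two_le; omega⟩
  obtain ⟨j, hj⟩ := M.exists_C_pos i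
  exact (M.one_le_C hj).trans ((Finset.single_le_sum (fun k _ => M.nonneg i k)
    (Finset.mem_univ j)).trans (M.sum_C_le_gamma i))

lemma one_le_psiTilde : 1 ≤ M.psiTilde := by
  have i : Fin n := ⟨0, by have := M.two_le; omega⟩
  exact (M.one_le_potential i).trans (M.potential_le_psiTilde i)

lemma C_eq_zero_of_not_pos {i j : Fin n} (h : ¬ 0 < M.C i j) : M.C i j = 0 :=
  le_antisymm (not_lt.mp h) (M.nonneg i j)

lemma C_pos_comm {i j : Fin n} : 0 < M.C i j ↔ 0 < M.C j i := ⟨M.C_pos_symm, M.C_pos_symm⟩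

lemma psi_of_adj {i j : Fin n} (h : 0 < M.C i j) : M.psi i j = M.C i j / M.C j i := by
  have hp : M.IsPath i j 1 (fun l => if l = 0 then i else j) := by
    refine ⟨rfl, rfl, fun l hl => ?_⟩
    obtain rfl : l = 0 := by omega
    simpa using h
  rw [M.psi_eq hp, pathRatio]
  simp

lemma potential_mul_symm (i j : Fin n) :
    M.potential i * M.C i j = M.potential j * M.C j i := by
  by_cases h : 0 < M.C i j
  · have := M.C_pos_symm h
    rw [potential, potential, ← M.psi_mul _ i j, M.psi_of_adj h]
    field_simp
  · rw [M.C_eq_zero_of_not_pos h, M.C_eq_zero_of_not_pos (mt M.C_pos_symm h), mul_zero, mul_zero]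

/-- The maximum principle on the market graph. -/
lemma eq_of_balanced {G : Matrix (Fin n) (Fin n) ℝ} (hG : ∀ i j, 0 ≤ G i j)
    (hG' : ∀ i j, 0 < M.C i j → 0 < G i j) {y : Fin n → ℝ}
    (hy : ∀ j, ∑ i, G i j * (y j - y i) = 0) (i j : Fin n) : y i = y j := by
  have : Nonempty (Fin n) := ⟨i⟩
  obtain ⟨m, hm⟩ := Finite.exists_max y
  suffices H : ∀ i, y i = y m by rw [H i, H j]
  intro i
  obtain ⟨⟨k, w⟩, hw0, hwk, hw⟩ := M.exists_isPath m i
  dsimp only at hw0 hwk hw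
  have key : ∀ l, l ≤ k → y (w l) = y m := by
    intro l
    induction l with
    | zero => intro _; rw [hw0]
    | succ l ih =>
      intro hl
      have h1 := ih (by omega)
      -- At a maximum of y all terms of the balance equation are nonnegative, so each vanishes and
      -- the maximum spreads to the next vertex of the path.
      have h2 := (Finset.sum_eq_zero_iff_of_nonneg fun a _ => mul_nonneg (hG a (w l))
        (by rw [h1]; exact sub_nonneg.mpr (hm a))).mp (hy (w l)) (w (l + 1)) (Finset.mem_univ _)
      have h3 := hG' _ _ (M.C_pos_symm (hw l (by omega)))
      have := (mul_eq_zero.mp h2).resolve_left h3.ne'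
      linarith
  rw [← hwk]
  exact key k le_rfl

/-- The amount that participant `i` spends on good `j`. -/
noncomputable def spending (δ : ℝ) (p : Fin n → ℝ) : Matrix (Fin n) (Fin n) ℝ :=
  Matrix.of fun i j => p i * M.C i j / (p j ^ δ * M.P δ p i)

/-- `pᵢ ^ δ Pᵢ(p)`: the inverse of the fraction of the budget spent by `i` per unit of `Cᵢⱼ` at a
good `j` of the same price as `i`. -/
noncomputable def relP (δ : ℝ) (p : Fin n → ℝ) (i : Fin n) : ℝ := p i ^ δ * M.P δ p i

variable {M} {δ : ℝ} {r : Fin n → ℝ}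

lemma spending_nonneg (hr : ∀ i, 0 < r i) (i j : Fin n) : 0 ≤ M.spending δ r i j :=
  div_nonneg (mul_nonneg (hr i).le (M.nonneg i j))
    (mul_pos (Real.rpow_pos_of_pos (hr j) _) (M.P_pos δ hr i)).le

lemma demand_eq_spending_div (hr : ∀ i, 0 < r i) (i j : Fin n) :
    M.demand δ r i j = M.spending δ r i j / r j := by
  rw [demand, spending, Matrix.of_apply, Real.rpow_add (hr j), Real.rpow_one]
  have := (M.P_pos δ hr i).ne'
  have := (hr j).ne'
  have := (Real.rpow_pos_of_pos (hr j) δ).ne'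
  field_simp

lemma sum_spending_row (hr : ∀ i, 0 < r i) (i : Fin n) : ∑ j, M.spending δ r i j = r i := by
  have hP := (M.P_pos δ hr i).ne'
  have : ∀ j, M.spending δ r i j = r i / M.P δ r i * (M.C i j / r j ^ δ) := by
    intro j
    rw [spending, Matrix.of_apply]
    have := (Real.rpow_pos_of_pos (hr j) δ).ne'
    field_simp
  rw [Finset.sum_congr rfl fun j _ => this j, ← Finset.mul_sum]
  exact div_mul_cancel₀ _ hP

lemma IsEquilibrium.sum_spending_col (h : M.IsEquilibrium δ r) (j : Fin n) :
    ∑ i, M.spending δ r i j = r j := by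
  have h1 := h.2 j
  rw [totalDemand, Finset.sum_congr rfl fun i _ => demand_eq_spending_div h.1 i j,
    ← Finset.sum_div, div_eq_one_iff_eq (h.1 j).ne'] at h1
  exact h1

lemma relP_pos (hr : ∀ i, 0 < r i) (i : Fin n) : 0 < M.relP δ r i :=
  mul_pos (Real.rpow_pos_of_pos (hr i) _) (M.P_pos δ hr i)

/-- The first factor is symmetric in i and j thanks to the potential, the second depends on i only;
symmetry of spending thus reduces to constancy of the second factor. -/
lemma spending_eq_mul (hr : ∀ i, 0 < r i) (i j : Fin n) :
    M.spending δ r i j = M.potential i * M.C i j / (r i ^ δ * r j ^ δ) *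
      (r i ^ (1 + 2 * δ) / (M.potential i * M.relP δ r i)) := by
  have h1 := (Real.rpow_pos_of_pos (hr i) δ).ne'
  have h2 := (Real.rpow_pos_of_pos (hr j) δ).ne'
  have h3 := (M.P_pos δ hr i).ne'
  have h4 := (M.potential_pos i).ne'
  have e : r i ^ (1 + 2 * δ) = r i * (r i ^ δ * r i ^ δ) := by
    rw [← Real.rpow_add (hr i), Real.rpow_add (hr i), Real.rpow_one, two_mul]
  simp only [spending, relP, Matrix.of_apply]
  rw [e]
  field_simp

/-- Up to a constant factor, the equilibrium prices are given by
`rᵢ ^ (1 + δ) = potential i * Pᵢ(r)`. -/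
lemma IsEquilibrium.price_eq (h : M.IsEquilibrium δ r) (i j : Fin n) :
    r i ^ (1 + 2 * δ) / (M.potential i * M.relP δ r i) =
      r j ^ (1 + 2 * δ) / (M.potential j * M.relP δ r j) := by
  have hδ : ∀ i, 0 < r i ^ δ := fun i => Real.rpow_pos_of_pos (h.1 i) _
  set G : Matrix (Fin n) (Fin n) ℝ :=
    Matrix.of fun i j => M.potential i * M.C i j / (r i ^ δ * r j ^ δ) with hG
  have hGs : ∀ i j, G i j = G j i := by
    intro i j
    rw [hG, Matrix.of_apply, Matrix.of_apply, M.potential_mul_symm, mul_comm (r i ^ δ)]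
  set y : Fin n → ℝ := fun i => r i ^ (1 + 2 * δ) / (M.potential i * M.relP δ r i)
  have hB : ∀ i j, M.spending δ r i j = G i j * y i := spending_eq_mul h.1
  refine M.eq_of_balanced (G := G) (y := y) (fun i j => ?_) (fun i j hC => ?_) (fun j => ?_) i j
  · exact div_nonneg (mul_nonneg (M.potential_pos i).le (M.nonneg i j))
      (mul_pos (hδ i) (hδ j)).le
  · exact div_pos (mul_pos (M.potential_pos i) hC) (mul_pos (hδ i) (hδ j))
  -- Market clearing (column sum) and the budget (row sum) agree; by symmetry of G this is the
  -- balance equation for y.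
  · have h1 := h.sum_spending_col j
    have h2 := sum_spending_row (M := M) (δ := δ) h.1 j
    simp only [hB] at h1 h2
    simp only [mul_sub, Finset.sum_sub_distrib]
    rw [h1, ← h2, sub_eq_zero]
    exact Finset.sum_congr rfl fun i _ => by rw [hGs]

lemma IsEquilibrium.spending_symm (h : M.IsEquilibrium δ r) (i j : Fin n) :
    M.spending δ r i j = M.spending δ r j i := by
  rw [spending_eq_mul h.1, spending_eq_mul h.1, h.price_eq i j, M.potential_mul_symm,
    mul_comm (r i ^ δ)]

lemma IsEquilibrium.spending_isWeightedGraph (h : M.IsEquilibrium δ r) :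
    IsWeightedGraph (M.spending δ r) where
  symm := h.spending_symm
  nonneg := spending_nonneg h.1
  row_pos i := by rw [sum_spending_row h.1]; exact h.1 i

/-- Logarithmic differentiation along log prices moving at velocity e; the last term comes from the
price index `P`, whose logarithmic derivative averages e over the budget shares of i. -/
lemma hasDerivAt_demand (hr : ∀ i, 0 < r i) (e : Fin n → ℝ) (i j : Fin n) :
    HasDerivAt (fun t : ℝ => M.demand δ (fun k => r k * Real.exp (e k * t)) i j)
      (M.demand δ r i j * (e i - (1 + δ) * e j + δ * ∑ k, M.spending δ r i k / r i * e k)) 0 := by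
  have hpow : ∀ (k : Fin n) (s t : ℝ),
      (r k * Real.exp (e k * t)) ^ s = r k ^ s * Real.exp (s * e k * t) := by
    intro k s t
    rw [Real.mul_rpow (hr k).le (Real.exp_pos _).le, ← Real.exp_mul]
    congr 2; ring
  have hexp : ∀ a : ℝ, HasDerivAt (fun t : ℝ => Real.exp (a * t)) a 0 := by
    intro a
    have := ((hasDerivAt_id (0 : ℝ)).const_mul a).exp
    simpa using this
  have hP : HasDerivAt (fun t : ℝ => M.P δ (fun k => r k * Real.exp (e k * t)) i)
      (∑ k, M.C i k / r k ^ δ * (-δ * e k)) 0 := by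
    have : (fun t : ℝ => M.P δ (fun k => r k * Real.exp (e k * t)) i) =
        fun t => ∑ k, M.C i k / r k ^ δ * Real.exp (-δ * e k * t) := by
      ext t
      refine Finset.sum_congr rfl fun k _ => ?_
      rw [hpow, neg_mul, neg_mul, Real.exp_neg]
      field_simp
    rw [this]
    exact HasDerivAt.fun_sum fun k _ => (hexp _).const_mul _
  have hP0 : M.P δ (fun k => r k * Real.exp (e k * 0)) i = M.P δ r i := by simp
  have hPi := (M.P_pos δ hr i).ne'
  have hd := ((hexp (e i - (1 + δ) * e j)).const_mul
    (r i * M.C i j / r j ^ (1 + δ))).fun_div hP (by rw [hP0]; exact hPi)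
  have hfun : (fun t : ℝ => M.demand δ (fun k => r k * Real.exp (e k * t)) i j) =
      fun t => r i * M.C i j / r j ^ (1 + δ) * Real.exp ((e i - (1 + δ) * e j) * t) /
        M.P δ (fun k => r k * Real.exp (e k * t)) i := by
    ext t
    rw [demand, hpow, sub_mul, Real.exp_sub]
    have := (Real.rpow_pos_of_pos (hr j) (1 + δ)).ne'
    have := (Real.exp_pos ((1 + δ) * e j * t)).ne'
    have := (M.P_pos δ (p := fun k => r k * Real.exp (e k * t))
      (fun k => mul_pos (hr k) (Real.exp_pos _)) i).ne'
    field_simp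
  rw [hfun]
  refine hd.congr_deriv ?_
  rw [hP0]
  simp only [mul_zero, Real.exp_zero, mul_one]
  have hs : ∑ k, M.C i k / r k ^ δ * (-δ * e k) =
      -δ * M.P δ r i * ∑ k, M.spending δ r i k / r i * e k := by
    rw [Finset.mul_sum]
    refine Finset.sum_congr rfl fun k _ => ?_
    rw [spending, Matrix.of_apply]
    have := (Real.rpow_pos_of_pos (hr k) δ).ne'
    have := (hr i).ne'
    field_simp
  rw [hs, demand]
  have := (Real.rpow_pos_of_pos (hr j) (1 + δ)).ne'
  field_simp
  ring

lemma IsEquilibrium.dynamicsMatrix_eq (h : M.IsEquilibrium δ r) :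
    M.dynamicsMatrix δ r = walkMatrix (M.spending δ r)
      - (1 + δ) • (1 : Matrix (Fin n) (Fin n) ℝ)
      + δ • (walkMatrix (M.spending δ r) * walkMatrix (M.spending δ r)) := by
  have hW : ∀ i j, walkMatrix (M.spending δ r) i j = M.spending δ r i j / r i := by
    intro i j
    rw [walkMatrix, Matrix.of_apply, sum_spending_row h.1]
  ext j i
  set e : Fin n → ℝ := Pi.single i 1 with he
  have hfun : (fun t : ℝ => M.totalDemand δ
      (fun k => r k * Real.exp ((Pi.single i t : Fin n → ℝ) k)) j) =
      fun t => ∑ l, M.demand δ (fun k => r k * Real.exp (e k * t)) l j := by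
    ext t
    rw [totalDemand]
    refine Finset.sum_congr rfl fun l _ => ?_
    congr 1
    ext k
    congr 2
    by_cases hk : k = i
    · subst hk; simp [he]
    · simp [he, hk]
  have hd : HasDerivAt (fun t : ℝ => ∑ l, M.demand δ (fun k => r k * Real.exp (e k * t)) l j)
      _ 0 := HasDerivAt.fun_sum fun l _ => hasDerivAt_demand h.1 e l j
  rw [dynamicsMatrix, Matrix.of_apply, hfun, hd.deriv]
  -- Symmetry of spending is essential here: the shares of good j bought by the various l become the
  -- budget shares of j, so the last term of the derivative yields W² for a single matrix W.
  have h1 : ∀ l, M.demand δ r l j = walkMatrix (M.spending δ r) j l := by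
    intro l
    rw [demand_eq_spending_div h.1, h.spending_symm, hW]
  have h2 : ∑ l, walkMatrix (M.spending δ r) j l = 1 := by
    rw [Finset.sum_congr rfl fun l _ => hW j l, ← Finset.sum_div, sum_spending_row h.1,
      div_self (h.1 j).ne']
  simp only [h1, ← hW]
  have h3 : ∀ l, ∑ k, walkMatrix (M.spending δ r) l k * e k = walkMatrix (M.spending δ r) l i := by
    intro l; simp [he, Pi.single_apply]
  simp only [h3, mul_add, mul_sub, Finset.sum_add_distrib, Finset.sum_sub_distrib]
  rw [← Finset.sum_mul, h2, one_mul]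
  simp only [Matrix.add_apply, Matrix.sub_apply, Matrix.smul_apply, smul_eq_mul, Matrix.mul_apply]
  congr 1
  · simp [he, Pi.single_apply, Matrix.one_apply]
  · rw [Finset.mul_sum]
    exact Finset.sum_congr rfl fun l _ => by ring

end Market

/-! ### Bounds on equilibrium prices and spending -/

namespace Market

variable {n : ℕ} {M : Market n} {δ : ℝ} {r : Fin n → ℝ}

lemma spending_pos (hr : ∀ i, 0 < r i) {i j : Fin n} (hC : 0 < M.C i j) :
    0 < M.spending δ r i j :=
  div_pos (mul_pos (hr i) hC) (mul_pos (Real.rpow_pos_of_pos (hr j) _) (M.P_pos δ hr i))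

lemma log_spending (hr : ∀ i, 0 < r i) {i j : Fin n} (hC : 0 < M.C i j) :
    Real.log (M.spending δ r i j) = Real.log (r i) + Real.log (M.C i j) +
      δ * (Real.log (r i) - Real.log (r j)) - Real.log (M.relP δ r i) := by
  have h1 := Real.rpow_pos_of_pos (hr j) δ
  have h2 := Real.rpow_pos_of_pos (hr i) δ
  have h3 := M.P_pos δ hr i
  rw [spending, Matrix.of_apply, relP, Real.log_div (mul_pos (hr i) hC).ne' (mul_pos h1 h3).ne',
    Real.log_mul (hr i).ne' hC.ne', Real.log_mul h1.ne' h3.ne', Real.log_mul h2.ne' h3.ne',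
    Real.log_rpow (hr j), Real.log_rpow (hr i)]
  ring

lemma spending_le (hr : ∀ i, 0 < r i) (i j : Fin n) : M.spending δ r i j ≤ r i := by
  conv_rhs => rw [← sum_spending_row (M := M) (δ := δ) hr i]
  exact Finset.single_le_sum (fun k _ => spending_nonneg hr i k) (Finset.mem_univ j)

/-- `C i j * (r i / r j) ^ δ` is one of the nonnegative terms that sum to `relP`; equivalently,
spending on one good is within the budget. -/
lemma log_C_add_le_log_relP (hr : ∀ i, 0 < r i) {i j : Fin n} (hC : 0 < M.C i j) :
    Real.log (M.C i j) + δ * (Real.log (r i) - Real.log (r j)) ≤ Real.log (M.relP δ r i) := by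
  have := Real.log_le_log (spending_pos (δ := δ) hr hC) (spending_le hr i j)
  rw [log_spending hr hC] at this
  linarith

lemma IsEquilibrium.log_price_sub (h : M.IsEquilibrium δ r) {i j : Fin n} (hC : 0 < M.C i j) :
    (1 + 2 * δ) * (Real.log (r i) - Real.log (r j)) = Real.log (M.relP δ r i)
      - Real.log (M.relP δ r j) + Real.log (M.C j i) - Real.log (M.C i j) := by
  have := congrArg Real.log (h.spending_symm i j)
  rw [log_spending h.1 hC, log_spending h.1 (M.C_pos_symm hC)] at this
  linarith

lemma log_C_nonneg {i j : Fin n} (hC : 0 < M.C i j) : 0 ≤ Real.log (M.C i j) :=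
  Real.log_nonneg (M.one_le_C hC)

/-- For neighbours, symmetry of spending and the one-term bound at j give (r i / r j)^(1+δ) ≤ R with
R = `relP` at i. Hence R ≤ γ R^(δ/(1+δ)), which is solved for R. -/
lemma IsEquilibrium.log_relP_le (h : M.IsEquilibrium δ r) (hδ : 0 < δ) (i : Fin n) :
    Real.log (M.relP δ r i) ≤ (1 + δ) * Real.log M.gamma := by
  set a := Real.log (M.relP δ r i) with ha
  have hγ : 0 < M.gamma := one_pos.trans_le M.one_le_gamma
  have h1δ : 0 < 1 + δ := by linarith
  have key : M.relP δ r i ≤ M.gamma * Real.exp (δ / (1 + δ) * a) := by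
    have e : M.relP δ r i = ∑ j, M.C i j * (r i ^ δ / r j ^ δ) := by
      rw [relP, P, Finset.mul_sum]
      exact Finset.sum_congr rfl fun j _ => by ring
    rw [e]
    refine (Finset.sum_le_sum fun j _ => ?_).trans
      ((Finset.sum_mul ..).symm.le.trans
        (mul_le_mul_of_nonneg_right (M.sum_C_le_gamma i) (Real.exp_pos (δ / (1 + δ) * a)).le))
    by_cases hC : 0 < M.C i j
    · refine mul_le_mul_of_nonneg_left ?_ hC.le
      rw [Real.rpow_def_of_pos (h.1 i), Real.rpow_def_of_pos (h.1 j), ← Real.exp_sub,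
        Real.exp_le_exp, div_mul_eq_mul_div, le_div_iff₀ h1δ]
      have h1 := log_C_add_le_log_relP (δ := δ) h.1 (M.C_pos_symm hC)
      have h2 := h.log_price_sub hC
      have h3 := log_C_nonneg hC
      have h4 : (1 + δ) * (Real.log (r i) - Real.log (r j)) ≤ a := by linarith
      linarith [mul_le_mul_of_nonneg_left h4 hδ.le]
    · rw [M.C_eq_zero_of_not_pos hC, zero_mul, zero_mul]
  have hlog := Real.log_le_log (relP_pos h.1 i) key
  rw [Real.log_mul hγ.ne' (Real.exp_pos _).ne', Real.log_exp, ← ha, div_mul_eq_mul_div,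
    ← sub_le_iff_le_add] at hlog
  have e : a - δ * a / (1 + δ) = a / (1 + δ) := by field_simp; ring
  rw [e, div_le_iff₀ h1δ] at hlog
  linarith

/-- Take one neighbour j. Eliminating the price ratio between the one-term bound at i and symmetry
of spending bounds (1 + δ) log `relP` at i below by -δ log `relP` at j, to which the upper bound
applies. -/
lemma IsEquilibrium.le_log_relP (h : M.IsEquilibrium δ r) (hδ : 0 < δ) (i : Fin n) :
    -(δ * Real.log M.gamma) ≤ Real.log (M.relP δ r i) := by
  obtain ⟨j, hC⟩ := M.exists_C_pos i
  have h1 := log_C_add_le_log_relP (δ := δ) h.1 hC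
  have h2 := h.log_price_sub hC
  have h3 := log_C_nonneg hC
  have h4 := log_C_nonneg (M.C_pos_symm hC)
  have h5 := mul_le_mul_of_nonneg_left (h.log_relP_le hδ j) hδ.le
  have h6 := mul_nonneg hδ.le h3
  have h7 := mul_nonneg hδ.le h4
  have h8 : (1 + δ) * -(δ * Real.log M.gamma) ≤ (1 + δ) * Real.log (M.relP δ r i) := by
    have h9 := mul_le_mul_of_nonneg_left h1 (by linarith : 0 ≤ 1 + 2 * δ)
    have h10 := congrArg (fun z => δ * z) h2
    linarith
  exact le_of_mul_le_mul_left h8 (by linarith)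

lemma U_apply_of_pos {i j : Fin n} (hC : 0 < M.C i j) : M.U i j = 1 := by
  rw [U, Matrix.of_apply, if_pos hC]

lemma U_apply_of_not_pos {i j : Fin n} (hC : ¬ 0 < M.C i j) : M.U i j = 0 := by
  rw [U, Matrix.of_apply, if_neg hC]

lemma E_eq_mul_U (r : Fin n → ℝ) (i j : Fin n) : M.E r i j = √(r i * r j) * M.U i j := by
  by_cases hC : 0 < M.C i j <;> simp [E, U, hC]

lemma U_nonneg (i j : Fin n) : 0 ≤ M.U i j := by
  by_cases hC : 0 < M.C i j <;> simp [U, hC]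

lemma U_symm (i j : Fin n) : M.U i j = M.U j i := by
  rw [U, Matrix.of_apply, Matrix.of_apply]
  simp only [M.C_pos_comm (i := i)]

variable (M) in
lemma U_isWeightedGraph : IsWeightedGraph M.U where
  symm := U_symm
  nonneg := U_nonneg
  row_pos i := by
    obtain ⟨j, hC⟩ := M.exists_C_pos i
    exact Finset.sum_pos' (fun k _ => U_nonneg i k)
      ⟨j, Finset.mem_univ _, by rw [U_apply_of_pos hC]; exact one_pos⟩

variable (M) in
lemma E_isWeightedGraph (hr : ∀ i, 0 < r i) : IsWeightedGraph (M.E r) where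
  symm i j := by rw [E_eq_mul_U, E_eq_mul_U, U_symm, mul_comm (r i)]
  nonneg i j := by rw [E_eq_mul_U]; exact mul_nonneg (Real.sqrt_nonneg _) (U_nonneg i j)
  row_pos i := by
    obtain ⟨j, hC⟩ := M.exists_C_pos i
    refine Finset.sum_pos' (fun k _ => ?_) ⟨j, Finset.mem_univ _, ?_⟩
    · rw [E_eq_mul_U]; exact mul_nonneg (Real.sqrt_nonneg _) (U_nonneg i k)
    · rw [E_eq_mul_U, U_apply_of_pos hC, mul_one]
      exact Real.sqrt_pos.mpr (mul_pos (hr i) (hr j))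

lemma IsEquilibrium.spending_le_E (h : M.IsEquilibrium δ r) (i j : Fin n) :
    M.spending δ r i j ≤ M.E r i j := by
  rw [E_eq_mul_U]
  by_cases hC : 0 < M.C i j
  · rw [U_apply_of_pos hC, mul_one]
    refine Real.le_sqrt_of_sq_le ?_
    rw [sq]
    exact mul_le_mul (spending_le h.1 i j) (by rw [h.spending_symm]; exact spending_le h.1 j i)
      (spending_nonneg h.1 i j) (h.1 i).le
  · rw [U_apply_of_not_pos hC, spending, Matrix.of_apply, M.C_eq_zero_of_not_pos hC]
    simp

/-- By symmetry, the squared spending on an edge is `r i * r j * C i j * C j i` divided by the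
product of `relP` at i and at j. The positive entries of C are at least 1 and each `relP` is at most
γ^(1+δ). -/
lemma IsEquilibrium.E_le_spending (h : M.IsEquilibrium δ r) (hδ : 0 < δ) (i j : Fin n) :
    (M.gamma ^ (1 + δ))⁻¹ * M.E r i j ≤ M.spending δ r i j := by
  have hγ : 0 < M.gamma := one_pos.trans_le M.one_le_gamma
  have hγδ := Real.rpow_pos_of_pos hγ (1 + δ)
  rw [E_eq_mul_U]
  by_cases hC : 0 < M.C i j
  · have hrr := mul_pos (h.1 i) (h.1 j)
    have hs := Real.sqrt_pos.mpr hrr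
    rw [U_apply_of_pos hC, mul_one, ← Real.log_le_log_iff
      (mul_pos (inv_pos.mpr hγδ) hs) (spending_pos h.1 hC),
      Real.log_mul (inv_pos.mpr hγδ).ne' hs.ne',
      Real.log_inv, Real.log_rpow hγ, Real.log_sqrt hrr.le, Real.log_mul (h.1 i).ne' (h.1 j).ne',
      log_spending h.1 hC]
    have h1 := h.log_price_sub hC
    have h2 := log_C_nonneg hC
    have h3 := log_C_nonneg (M.C_pos_symm hC)
    linarith [h.log_relP_le hδ i, h.log_relP_le hδ j]
  · rw [U_apply_of_not_pos hC, mul_zero, mul_zero]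
    exact spending_nonneg h.1 i j

/-- In `price_eq` the potentials lie in [1, ψ̃] and the ratio of the `relP` values is at most
γ^(1+2δ), so the price ratio is at most ψ̃^(1/(1+2δ)) γ. -/
lemma IsEquilibrium.price_le (h : M.IsEquilibrium δ r) (hδ : 0 < δ) (i j : Fin n) :
    r i ≤ M.psiTilde * M.gamma * r j := by
  have hγ : 0 < M.gamma := one_pos.trans_le M.one_le_gamma
  have hψ : 0 < M.psiTilde := one_pos.trans_le M.one_le_psiTilde
  have hlog : ∀ i, Real.log (r i ^ (1 + 2 * δ) / (M.potential i * M.relP δ r i)) =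
      (1 + 2 * δ) * Real.log (r i) - Real.log (M.potential i) - Real.log (M.relP δ r i) := by
    intro i
    rw [Real.log_div (Real.rpow_pos_of_pos (h.1 i) _).ne'
      (mul_pos (M.potential_pos i) (relP_pos h.1 i)).ne', Real.log_rpow (h.1 i),
      Real.log_mul (M.potential_pos i).ne' (relP_pos h.1 i).ne']
    ring
  have h1 := congrArg Real.log (h.price_eq i j)
  rw [hlog, hlog] at h1
  have h2 := Real.log_le_log (M.potential_pos i) (M.potential_le_psiTilde i)
  have h3 := Real.log_nonneg (M.one_le_potential j)
  have h4 := h.log_relP_le hδ i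
  have h5 := h.le_log_relP hδ j
  -- Since ψ̃ ≥ 1, its exponent 1 / (1 + 2δ) may be raised to 1.
  have h6 := mul_nonneg hδ.le (Real.log_nonneg M.one_le_psiTilde)
  rw [← Real.log_le_log_iff (h.1 i) (mul_pos (mul_pos hψ hγ) (h.1 j)),
    Real.log_mul (mul_pos hψ hγ).ne' (h.1 j).ne', Real.log_mul hψ.ne' hγ.ne']
  refine le_of_mul_le_mul_left ?_ (by linarith : 0 < 1 + 2 * δ)
  linarith

end Market

/-! ### The comparison bounds -/

theorem theorem5 {n : ℕ} (M : Market n) (δ : ℝ) (hδ : 0 < δ) (r : Fin n → ℝ)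
    (hr : M.IsEquilibrium δ r) :
    (M.dynamicsMatrix δ r).charpoly.Splits ∧
    (qPoly δ (min (min (M.psiTilde * M.gamma ^ (2 + δ) * eigUp 2 (lap M.U)) (1 + 1 / (2 * δ)))
          (1 + 1 / ((n : ℝ) - 1)))
        ≤ eigDown 2 (M.dynamicsMatrix δ r) ∧
      eigDown 2 (M.dynamicsMatrix δ r)
        ≤ max (qPoly δ (eigUp 2 (lap M.U) / (M.psiTilde * M.gamma ^ (2 + δ)))) (-2)) ∧
    (qPoly δ (min (min (M.gamma ^ (1 + δ) * eigUp 2 (lap (M.E r))) (1 + 1 / (2 * δ)))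
          (1 + 1 / ((n : ℝ) - 1)))
        ≤ eigDown 2 (M.dynamicsMatrix δ r) ∧
      eigDown 2 (M.dynamicsMatrix δ r)
        ≤ max (qPoly δ (eigUp 2 (lap (M.E r)) / M.gamma ^ (1 + δ))) (-2)) := by
  have hB := hr.spending_isWeightedGraph
  have hγ : 0 < M.gamma := one_pos.trans_le M.one_le_gamma
  have hψ : 0 < M.psiTilde := one_pos.trans_le M.one_le_psiTilde
  have hγδ := Real.rpow_pos_of_pos hγ (1 + δ)
  refine ⟨?_, ?_, ?_⟩
  · obtain ⟨V, v, h⟩ := hB.lap_isSymm.exists_orthoDiag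
    rw [hr.dynamicsMatrix_eq, hB.exists_conj_quadratic h]
    exact Polynomial.Splits.prod fun k _ => Polynomial.Splits.X_sub_C _
  · have : Nonempty (Fin n) := ⟨⟨0, by have := M.two_le; omega⟩⟩
    -- Measured against the cheapest good l, every √(r i * r j) lies between `r l` and ψ̃ γ `r l`;
    -- the factor `r l` cancels in the ratio K / m.
    obtain ⟨l, hl⟩ := Finite.exists_min r
    have hlow : ∀ i j, (M.gamma ^ (1 + δ))⁻¹ * r l * M.U i j ≤ M.spending δ r i j := by
      intro i j
      refine le_trans ?_ (hr.E_le_spending hδ i j)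
      rw [Market.E_eq_mul_U, mul_assoc]
      refine mul_le_mul_of_nonneg_left (mul_le_mul_of_nonneg_right ?_ (Market.U_nonneg i j))
        (inv_pos.mpr hγδ).le
      refine Real.le_sqrt_of_sq_le ?_
      rw [sq]
      exact mul_le_mul (hl i) (hl j) (hr.1 l).le (hr.1 i).le
    have hup : ∀ i j, M.spending δ r i j ≤ M.psiTilde * M.gamma * r l * M.U i j := by
      intro i j
      refine (hr.spending_le_E i j).trans ?_
      rw [Market.E_eq_mul_U]
      refine mul_le_mul_of_nonneg_right ?_ (Market.U_nonneg i j)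
      have hp := mul_pos (mul_pos hψ hγ) (hr.1 l)
      refine Real.sqrt_le_iff.mpr ⟨hp.le, ?_⟩
      rw [sq]
      exact mul_le_mul (hr.price_le hδ i l) (hr.price_le hδ j l) (hr.1 j).le hp.le
    have hκ : M.psiTilde * M.gamma * r l / ((M.gamma ^ (1 + δ))⁻¹ * r l) =
        M.psiTilde * M.gamma ^ (2 + δ) := by
      have e : M.gamma ^ (2 + δ) = M.gamma * M.gamma ^ (1 + δ) := by
        rw [← Real.rpow_one_add' hγ.le (by linarith)]
        congr 1; ring
      have := (hr.1 l).ne'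
      rw [e]
      field_simp
    have := M.U_isWeightedGraph.eigDown_two_bounds hB M.two_le hδ
      (mul_pos (inv_pos.mpr hγδ) (hr.1 l)) (mul_pos (mul_pos hψ hγ) (hr.1 l)) hlow hup
      hr.dynamicsMatrix_eq
    rwa [hκ] at this
  · have := (M.E_isWeightedGraph hr.1).eigDown_two_bounds hB M.two_le hδ (inv_pos.mpr hγδ) one_pos
      (hr.E_le_spending hδ) (fun i j => by rw [one_mul]; exact hr.spending_le_E i j)
      hr.dynamicsMatrix_eq
    rwa [one_div, inv_inv] at this
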